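/- Let $\Gamma$ be a regular rooted metric tree with root $o$: all vertices of generation $n$ have the same branching number $b_n$ (with $b_0=1$ and $1<b_n<\infty$ for $n\ge 1$) and lie at the same distance $t_n$ from $o$, where $0=t_0<t_1<\dots$ and $t_n\to\infty$. Write $|x|$ for the distance from $x$ to $o$ and $dx$ for the measure on $\Gamma$ induced by the Lebesgue measure on the edges. Let $H^{1}(\Gamma)$ be the space of continuous functions $u$ on $\Gamma$ that lie in $H^1(e)$ on each edge $e$ and satisfy $\int_\Gamma(|u'|^2+|u|^2)\,dx<\infty$, and let $H^{1,0}(\Gamma)=\{u\in H^1(\Gamma):u(o)=0\}$. Let $\Psi(x)=\psi(|x|)>0$ ($x\ne o$), with $\psi$ measurable, be a symmetric Hardy weight that is normalized, i.e. $C=1$ is the least constant such that $$\int_\Gamma \Psi|u|^2dx\le C\int_\Gamma|u'|^2dx\qquad\text{for all }u\in H^{1,0}(\Gamma),$$ and let $\Phi(x)=|x|\Psi(x)$. Let $p>1$ and let $V\ge 0$ be a measurable function on $\Gamma$. For $\alpha>0$ let $\mathbf H_{\alpha V}=-\Delta_D-\alpha V$ be the operator in $L_2(\Gamma)$ defined by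 the quadratic form $\int_\Gamma(|u'|^2-\alpha V|u|^2)\,dx$, $u\in H^{1,0}(\Gamma)$, and let $N_-(\mathbf H_{\alpha V})$ be the number of its negative eigenvalues, counted with multiplicities. Then there is a constant $C$, depending only on $p$, such that the following holds. (1) Suppose that $V\Psi^{-1}\in L_{p,w}(\Gamma,\Phi)$, i.e. $\sup_{t>0}t^p\int_{V>t\Psi}\Phi\,dx<\infty$. Then for each $\alpha>0$ the form is finite on $H^{1,0}(\Gamma)$, bounded below and closed, $\mathbf H_{\alpha V}$ is self-adjoint, and its negative spectrum is finite. Moreover, $$N_-(\mathbf H_{\alpha V})\le C\alpha^p\sup_{t>0}\Big(t^p\int_{V(x)>t\Psi(x)}\Phi(x)\,dx\Big)\qquad\text{for all }\alpha>0,$$ $$\limsup_{\alpha\to\infty}\alpha^{-p}N_-(\mathbf H_{\alpha V})\le C\limsup_{t+t^{-1}\to\infty}\Big(t^p\int_{V(x)>t\Psi(x)}\Phi(x)\,dx\Big).$$ In particular, if $\int_{V>t\Psi}\Phi\,dx=o(t^{-p})$ as $t+t^{-1}\to\infty$ (i.e. both as $t\to0^+$ and as $t\to\infty$), then $N_-(\mathbf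 H_{\alpha V})=o(\alpha^p)$ as $\alpha\to\infty$. (2) Suppose that $V\Psi^{-1}$ belongs to the narrower space $L_p(\Gamma,\Phi)$. Then $\mathbf H_{\alpha V}$ is well defined as in (1) with finite negative spectrum, $$N_-(\mathbf H_{\alpha V})\le C\alpha^p\int_\Gamma|x|V^p\Psi^{1-p}\,dx\qquad\text{for all }\alpha>0,$$ and $N_-(\mathbf H_{\alpha V})=o(\alpha^p)$ as $\alpha\to\infty$. -/

import Mathlib

open MeasureTheory Filter Topology Set
open scoped ENNReal NNReal ComplexConjugate

noncomputable section

/-- The data of a regular rooted metric tree: all vertices of generation `n` have branching number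
`branch n` and lie at distance `level n` from the root. -/
structure RegularTree where
  branch : ℕ → ℕ
  level : ℕ → ℝ
  branch_zero : branch 0 = 1
  one_lt_branch : ∀ n, n ≠ 0 → 1 < branch n
  level_zero : level 0 = 0
  level_strictMono : StrictMono level
  level_unbounded : Tendsto level atTop atTop

namespace RegularTree

variable (Γ : RegularTree)

theorem branch_pos (n : ℕ) : 0 < Γ.branch n := by
  rcases eq_or_ne n 0 with rfl | h
  · rw [Γ.branch_zero]; exact one_pos
  · exact lt_trans one_pos (Γ.one_lt_branch n h)

/-- An edge, given by its generation `n` and by the choices made at the vertices of generations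
`0, …, n` on the way from the root. It joins a vertex of generation `n` to one of
generation `n + 1`. -/
abbrev Edge : Type := Σ n : ℕ, ((i : Fin (n + 1)) → Fin (Γ.branch i))

/-- The heights `|x|` of the points of an edge, without its lower end. -/
abbrev edgeInterval (e : Γ.Edge) : Set ℝ := Ioc (Γ.level e.1) (Γ.level (e.1 + 1))

/-- A point of the metric tree: each edge carries its upper end but not its lower end, except that
the (unique) edge of generation `0` also carries the root. The number `height` is the distance
`|x|` to the root. -/
@[ext]
structure Point where
  edge : Γ.Edge
  height : ℝ
  mem : height ∈ Γ.edgeInterval edge ∨ (edge.1 = 0 ∧ height = 0)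

variable {Γ}

/-- The partial order of the tree: `x ≤ y` means that `x` lies on the path from the root to `y`. -/
instance : LE Γ.Point where
  le x y := x.height ≤ y.height ∧
    ∃ h : x.edge.1 ≤ y.edge.1,
      ∀ i : Fin (x.edge.1 + 1), x.edge.2 i = y.edge.2 (Fin.castLE (Nat.succ_le_succ h) i)

variable (Γ) in
/-- The root `o`. -/
def root : Γ.Point where
  edge := ⟨0, fun i => ⟨0, Γ.branch_pos i⟩⟩
  height := 0
  mem := Or.inr ⟨rfl, rfl⟩

/-- The height of the last common point of the paths from the root to `x` and to `y`. -/
def meetHeight (x y : Γ.Point) : ℝ := sSup (Point.height '' {z : Γ.Point | z ≤ x ∧ z ≤ y})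

namespace Point

theorem le_refl' (x : Γ.Point) : x ≤ x := ⟨le_rfl, le_rfl, fun _ => rfl⟩

theorem le_trans' {x y z : Γ.Point} (h1 : x ≤ y) (h2 : y ≤ z) : x ≤ z := by
  obtain ⟨a1, b1, c1⟩ := h1
  obtain ⟨a2, b2, c2⟩ := h2
  refine ⟨a1.trans a2, b1.trans b2, fun i => ?_⟩
  rw [c1 i]
  exact c2 (Fin.castLE (Nat.succ_le_succ b1) i)

theorem root_le (x : Γ.Point) : Γ.root ≤ x := by
  refine ⟨?_, Nat.zero_le _, fun i => ?_⟩
  · rcases x.mem with h | h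
    · have h0 : Γ.level 0 ≤ Γ.level x.edge.1 := Γ.level_strictMono.monotone (Nat.zero_le _)
      rw [Γ.level_zero] at h0
      exact h0.trans h.1.le
    · exact h.2.symm.le
  · have hi : i = 0 := Subsingleton.elim (α := Fin 1) i 0
    subst hi
    have hs : Subsingleton (Fin (Γ.branch 0)) := by rw [Γ.branch_zero]; infer_instance
    exact hs.elim _ _

theorem level_le (x : Γ.Point) : Γ.level x.edge.1 ≤ x.height := by
  rcases x.mem with h | h
  · exact h.1.le
  · rw [h.1, h.2, Γ.level_zero]

theorem le_level (x : Γ.Point) : x.height ≤ Γ.level (x.edge.1 + 1) := by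
  rcases x.mem with h | h
  · exact h.2
  · rw [h.2, ← Γ.level_zero]
    exact Γ.level_strictMono.monotone (Nat.zero_le _)

theorem gen_le_of_height_le {x y : Γ.Point} (h : x.height ≤ y.height) :
    x.edge.1 ≤ y.edge.1 := by
  rcases x.mem with hx | hx
  · have h1 := hx.1.trans_le (h.trans y.le_level)
    exact Nat.lt_succ_iff.1 (Γ.level_strictMono.lt_iff_lt.1 h1)
  · rw [hx.1]; exact Nat.zero_le _

/-- Two points below a third one are comparable. -/
theorem le_of_le_of_le {x y z : Γ.Point} (hx : x ≤ z) (hy : y ≤ z)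
    (h : x.height ≤ y.height) : x ≤ y := by
  refine ⟨h, gen_le_of_height_le h, fun i => ?_⟩
  rw [hx.2.2 i]
  exact (hy.2.2 (Fin.castLE (Nat.succ_le_succ (gen_le_of_height_le h)) i)).symm

theorem eq_of_le_of_height_eq {x y : Γ.Point} (hxy : x ≤ y) (h : x.height = y.height) :
    x = y := by
  have hg : x.edge.1 = y.edge.1 :=
    _root_.le_antisymm hxy.2.1 (gen_le_of_height_le h.ge)
  obtain ⟨⟨n, p⟩, s, hs⟩ := x
  obtain ⟨⟨m, q⟩, r, hr⟩ := y
  simp only at hg h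
  subst hg
  subst h
  have hpq : p = q := funext fun i => hxy.2.2 i
  subst hpq
  rfl

theorem bddAbove_common (x y : Γ.Point) :
    BddAbove (height '' {z : Γ.Point | z ≤ x ∧ z ≤ y}) :=
  ⟨x.height, by rintro _ ⟨z, hz, rfl⟩; exact hz.1.1⟩

theorem nonempty_common (x y : Γ.Point) :
    (height '' {z : Γ.Point | z ≤ x ∧ z ≤ y}).Nonempty :=
  ⟨_, Γ.root, ⟨root_le x, root_le y⟩, rfl⟩

theorem meetHeight_comm (x y : Γ.Point) : meetHeight x y = meetHeight y x := by
  unfold meetHeight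
  simp only [and_comm]

theorem meetHeight_le (x y : Γ.Point) : meetHeight x y ≤ x.height :=
  csSup_le (nonempty_common x y) (by rintro _ ⟨z, hz, rfl⟩; exact hz.1.1)

theorem le_meetHeight {x y z : Γ.Point} (hx : z ≤ x) (hy : z ≤ y) :
    z.height ≤ meetHeight x y :=
  le_csSup (bddAbove_common x y) ⟨z, ⟨hx, hy⟩, rfl⟩

theorem min_meetHeight_le (x y z : Γ.Point) :
    min (meetHeight x y) (meetHeight y z) ≤ meetHeight x z := by
  refine le_of_forall_lt fun c hc => ?_
  obtain ⟨h1, h2⟩ := lt_min_iff.1 hc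
  obtain ⟨_, ⟨u, hu, rfl⟩, hcu⟩ := exists_lt_of_lt_csSup (nonempty_common x y) h1
  obtain ⟨_, ⟨v, hv, rfl⟩, hcv⟩ := exists_lt_of_lt_csSup (nonempty_common y z) h2
  rcases le_total u.height v.height with h | h
  · exact hcu.trans_le
      (le_meetHeight hu.1 (le_trans' (le_of_le_of_le hu.2 hv.1 h) hv.2))
  · exact hcv.trans_le
      (le_meetHeight (le_trans' (le_of_le_of_le hv.1 hu.2 h) hu.1) hv.2)

theorem le_of_height_le_meetHeight {x y : Γ.Point} (h : x.height ≤ meetHeight x y) :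
    x ≤ y := by
  have hxy : x.height ≤ y.height := h.trans (by rw [meetHeight_comm]; exact meetHeight_le y x)
  refine ⟨hxy, gen_le_of_height_le hxy, fun i => ?_⟩
  rcases x.mem with hx | hx
  · obtain ⟨_, ⟨z, hz, rfl⟩, hlt⟩ :=
      exists_lt_of_lt_csSup (nonempty_common x y) (hx.1.trans_le h)
    have hg : x.edge.1 ≤ z.edge.1 := by
      have h1 := hlt.trans_le z.le_level
      exact Nat.lt_succ_iff.1 (Γ.level_strictMono.lt_iff_lt.1 h1)
    have e1 := hz.1.2.2 (Fin.castLE (Nat.succ_le_succ hg) i)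
    have e2 := hz.2.2.2 (Fin.castLE (Nat.succ_le_succ hg) i)
    exact e1.symm.trans e2
  · have hxr : x = Γ.root := by
      refine (eq_of_le_of_height_eq (root_le x) ?_).symm
      rw [hx.2]; rfl
    subst hxr
    exact (root_le y).2.2 i

end Point

/-- The tree with the path distance `ρ(x, y) = |x| + |y| - 2 |x ∧ y|`, where `x ∧ y` is the last
common point of the paths from the root to `x` and to `y`. -/
instance : MetricSpace Γ.Point where
  dist x y := x.height + y.height - 2 * meetHeight x y
  dist_self x := by
    have h1 := Point.meetHeight_le x x
    have h2 := Point.le_meetHeight (Point.le_refl' x) (Point.le_refl' x)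
    change x.height + x.height - 2 * meetHeight x x = 0
    linarith
  dist_comm x y := by
    rw [Point.meetHeight_comm x y]; ring
  dist_triangle x y z := by
    have h1 := Point.min_meetHeight_le x y z
    have h2 := Point.meetHeight_le y x
    have h3 := Point.meetHeight_le y z
    rw [Point.meetHeight_comm] at h2
    rcases min_le_iff.1 h1 with h | h <;> linarith
  eq_of_dist_eq_zero {x y} h := by
    change x.height + y.height - 2 * meetHeight x y = 0 at h
    have h2 := Point.meetHeight_le x y
    have h3 := Point.meetHeight_le y x
    rw [Point.meetHeight_comm] at h3
    exact Point.eq_of_le_of_height_eq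
      (Point.le_of_height_le_meetHeight (by linarith)) (by linarith)

instance : MeasurableSpace Γ.Point := borel _

instance : BorelSpace Γ.Point := ⟨rfl⟩

/-- The point of height `s` on the edge `e`, for `s ∈ Γ.edgeInterval e`; for the other values of `s`
(which are never used) it is the upper end of `e`. -/
def onEdge (e : Γ.Edge) (s : ℝ) : Γ.Point :=
  open Classical in
  if h : s ∈ Γ.edgeInterval e then ⟨e, s, Or.inl h⟩
  else ⟨e, Γ.level (e.1 + 1), Or.inl ⟨Γ.level_strictMono (Nat.lt_succ_self _), le_rfl⟩⟩

/-- The measure `dx` on the tree, induced by the Lebesgue measure on the edges. -/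
instance : MeasureSpace Γ.Point where
  volume := Measure.sum fun e : Γ.Edge =>
    ((volume : Measure ℝ).restrict (Γ.edgeInterval e)).map (onEdge e)

/-- `u ∈ H¹(Γ)`, with derivative `u'`: the function `u` is continuous on the tree, on each edge it is
absolutely continuous with a.e. derivative `u'` (in the direction away from the root), and both
`u` and `u'` are square integrable. -/
structure MemH1 (u u' : Γ.Point → ℂ) : Prop where
  continuous : Continuous u
  memLp : MemLp u 2 volume
  memLp_deriv : MemLp u' 2 volume
  sub_eq_integral : ∀ e : Γ.Edge, ∀ a ∈ Γ.edgeInterval e, ∀ b ∈ Γ.edgeInterval e,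
    u (onEdge e b) - u (onEdge e a) = ∫ s in a..b, u' (onEdge e s)

/-- `u ∈ H^{1,0}(Γ)`, with derivative `u'`. -/
structure MemH10 (u u' : Γ.Point → ℂ) : Prop extends MemH1 u u' where
  root_eq_zero : u Γ.root = 0

/-- The least `C` (possibly `∞`) such that `∫ W |u|² dx ≤ C ∫ |u'|² dx` for all `u ∈ H^{1,0}(Γ)`. -/
def hardyConstant (W : Γ.Point → ℝ) : ℝ≥0∞ :=
  sInf {C : ℝ≥0∞ | ∀ u u' : Γ.Point → ℂ, MemH10 u u' →
    ∫⁻ x, ENNReal.ofReal (W x) * ‖u x‖ₑ ^ 2 ≤ C * ∫⁻ x, ‖u' x‖ₑ ^ 2}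

/-- The radial function `x ↦ ψ (|x|)`. -/
def radial (ψ : ℝ → ℝ) : Γ.Point → ℝ := fun x => ψ x.height

/-- The measure `Φ dx` with `Φ(x) = |x| Ψ(x)`. -/
def weightedMeasure (Ψ : Γ.Point → ℝ) : Measure Γ.Point :=
  volume.withDensity fun x => ENNReal.ofReal (x.height * Ψ x)

/-- The quadratic form `∫ (|u'|² - W |u|²) dx`. -/
def schrodingerForm (W : Γ.Point → ℝ) (u u' : Γ.Point → ℂ) : ℝ :=
  ∫ x, (‖u' x‖ ^ 2 - W x * ‖u x‖ ^ 2)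

variable (Γ) in
/-- The complex Hilbert space `L₂(Γ)`. -/
abbrev L2 : Type := Lp ℂ 2 (volume : Measure Γ.Point)

theorem onEdge_of_mem {e : Γ.Edge} {s : ℝ} (h : s ∈ Γ.edgeInterval e) :
    onEdge e s = ⟨e, s, Or.inl h⟩ := dif_pos h

theorem dist_onEdge {e : Γ.Edge} {a b : ℝ} (ha : a ∈ Γ.edgeInterval e)
    (hb : b ∈ Γ.edgeInterval e) : dist (onEdge e a) (onEdge e b) = |a - b| := by
  wlog hab : a ≤ b generalizing a b
  · rw [dist_comm, abs_sub_comm]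
    exact this hb ha (le_of_not_ge hab)
  have hle : onEdge e a ≤ onEdge e b := by
    rw [onEdge_of_mem ha, onEdge_of_mem hb]
    exact ⟨hab, le_rfl, fun _ => rfl⟩
  have h1 := Point.meetHeight_le (onEdge e a) (onEdge e b)
  have h2 := Point.le_meetHeight (Point.le_refl' _) hle
  have h3 : (onEdge e a).height = a := by rw [onEdge_of_mem ha]
  have h4 : (onEdge e b).height = b := by rw [onEdge_of_mem hb]
  change (onEdge e a).height + (onEdge e b).height - 2 * meetHeight (onEdge e a) (onEdge e b) = _
  rw [abs_of_nonpos (by linarith)]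
  linarith

theorem continuousOn_onEdge (e : Γ.Edge) : ContinuousOn (onEdge e) (Γ.edgeInterval e) := by
  rw [Metric.continuousOn_iff]
  intro b hb ε hε
  refine ⟨ε, hε, fun a ha hab => ?_⟩
  rw [dist_onEdge ha hb]
  rwa [Real.dist_eq] at hab

theorem aemeasurable_onEdge (e : Γ.Edge) :
    AEMeasurable (onEdge e) ((volume : Measure ℝ).restrict (Γ.edgeInterval e)) := by
  have h : Measurable ((Γ.edgeInterval e).domRestrict (onEdge e)) :=
    (continuousOn_iff_continuous_domRestrict.1 (continuousOn_onEdge e)).measurable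
  exact aemeasurable_restrict_of_measurable_subtype measurableSet_Ioc h

theorem map_onEdge_le (e : Γ.Edge) :
    ((volume : Measure ℝ).restrict (Γ.edgeInterval e)).map (onEdge e) ≤
      (volume : Measure Γ.Point) :=
  Measure.le_sum (fun e : Γ.Edge =>
    ((volume : Measure ℝ).restrict (Γ.edgeInterval e)).map (onEdge e)) e

theorem intervalIntegrable_onEdge {g : Γ.Point → ℂ} (hg : MemLp g 2 volume) (e : Γ.Edge) {a b : ℝ}
    (ha : a ∈ Γ.edgeInterval e) (hb : b ∈ Γ.edgeInterval e) :
    IntervalIntegrable (fun s => g (onEdge e s)) volume a b := by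
  have h1 : MemLp g 2 (((volume : Measure ℝ).restrict (Γ.edgeInterval e)).map (onEdge e)) :=
    hg.mono_measure (map_onEdge_le e)
  have h2 : MemLp (g ∘ onEdge e) 2 ((volume : Measure ℝ).restrict (Γ.edgeInterval e)) :=
    (memLp_map_measure_iff h1.aestronglyMeasurable (aemeasurable_onEdge e)).1 h1
  have h3 : IntegrableOn (g ∘ onEdge e) (Γ.edgeInterval e) volume :=
    h2.integrable one_le_two
  rw [intervalIntegrable_iff]
  refine h3.mono_set fun s hs => ?_
  exact ⟨(lt_min ha.1 hb.1).trans hs.1, hs.2.trans (max_le ha.2 hb.2)⟩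

theorem MemH10.zero : MemH10 (0 : Γ.Point → ℂ) 0 where
  continuous := continuous_const
  memLp := MemLp.zero
  memLp_deriv := MemLp.zero
  sub_eq_integral := by intros; simp
  root_eq_zero := rfl

theorem MemH10.add {u u' v v' : Γ.Point → ℂ} (hu : MemH10 u u') (hv : MemH10 v v') :
    MemH10 (u + v) (u' + v') where
  continuous := hu.continuous.add hv.continuous
  memLp := hu.memLp.add hv.memLp
  memLp_deriv := hu.memLp_deriv.add hv.memLp_deriv
  sub_eq_integral e a ha b hb := by
    have h1 := hu.sub_eq_integral e a ha b hb
    have h2 := hv.sub_eq_integral e a ha b hb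
    simp only [Pi.add_apply]
    rw [intervalIntegral.integral_add (intervalIntegrable_onEdge hu.memLp_deriv e ha hb)
      (intervalIntegrable_onEdge hv.memLp_deriv e ha hb), ← h1, ← h2]
    ring
  root_eq_zero := by simp [hu.root_eq_zero, hv.root_eq_zero]

theorem MemH10.smul {u u' : Γ.Point → ℂ} (c : ℂ) (hu : MemH10 u u') :
    MemH10 (c • u) (c • u') where
  continuous := hu.continuous.const_smul c
  memLp := hu.memLp.const_smul c
  memLp_deriv := hu.memLp_deriv.const_smul c
  sub_eq_integral e a ha b hb := by
    have h1 := hu.sub_eq_integral e a ha b hb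
    simp only [Pi.smul_apply]
    rw [intervalIntegral.integral_smul, ← h1, smul_sub]
  root_eq_zero := by simp [hu.root_eq_zero]

/-- The graph of the operator `-Δ_D - W` defined via its quadratic form: the pairs `(f, h)` in
`L₂(Γ) × L₂(Γ)` such that `f` is (the class of) some `u ∈ H^{1,0}(Γ)` and
`∫ (u' v̄' - W u v̄) dx = ∫ h v̄ dx` for all `v ∈ H^{1,0}(Γ)`. -/
def schrodingerGraph (W : Γ.Point → ℝ) : Submodule ℂ (L2 Γ × L2 Γ) where
  carrier := {q | ∃ u u' : Γ.Point → ℂ, MemH10 u u' ∧ q.1 =ᵐ[volume] u ∧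
    ∀ v v' : Γ.Point → ℂ, MemH10 v v' →
      Integrable (fun x => u' x * conj (v' x) - W x * (u x * conj (v x))) volume ∧
      ∫ x, (u' x * conj (v' x) - W x * (u x * conj (v x))) = ∫ x, q.2 x * conj (v x)}
  zero_mem' := by
    refine ⟨0, 0, MemH10.zero, Lp.coeFn_zero _ _ _, fun v v' _ => ⟨by simp, ?_⟩⟩
    have h0 : ∫ x, ((0 : L2 Γ × L2 Γ).2 x) * conj (v x) = 0 := by
      rw [← integral_zero Γ.Point ℂ]
      refine integral_congr_ae ?_
      filter_upwards [Lp.coeFn_zero ℂ 2 (volume : Measure Γ.Point)] with x hx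
      change ((0 : L2 Γ) : Γ.Point → ℂ) x * conj (v x) = 0
      rw [hx, Pi.zero_apply, zero_mul]
    rw [h0]
    simp
  add_mem' := by
    rintro q r ⟨u, u', hu, hqu, hq⟩ ⟨w, w', hw, hrw, hr⟩
    refine ⟨u + w, u' + w', hu.add hw, (Lp.coeFn_add _ _).trans (hqu.add hrw),
      fun v v' hv => ?_⟩
    obtain ⟨i1, e1⟩ := hq v v' hv
    obtain ⟨i2, e2⟩ := hr v v' hv
    have hfun : (fun x => (u' + w') x * conj (v' x) - W x * ((u + w) x * conj (v x))) =
        fun x => (u' x * conj (v' x) - W x * (u x * conj (v x))) +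
          (w' x * conj (v' x) - W x * (w x * conj (v x))) := by
      funext x
      simp only [Pi.add_apply]
      ring
    have hint : ∀ g : L2 Γ, Integrable (fun x => g x * conj (v x)) volume := fun g =>
      (Lp.memLp g).integrable_mul (q := 2) hv.memLp.star
    refine ⟨by rw [hfun]; exact i1.add i2, ?_⟩
    rw [hfun, integral_add i1 i2, e1, e2, ← integral_add (hint _) (hint _)]
    refine integral_congr_ae ?_
    filter_upwards [Lp.coeFn_add q.2 r.2] with x hx
    simp only [Prod.snd_add, hx, Pi.add_apply]
    ring
  smul_mem' := by
    rintro c q ⟨u, u', hu, hqu, hq⟩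
    refine ⟨c • u, c • u', hu.smul c, (Lp.coeFn_smul _ _).trans (hqu.const_smul c),
      fun v v' hv => ?_⟩
    obtain ⟨i1, e1⟩ := hq v v' hv
    have hfun : (fun x => (c • u') x * conj (v' x) - W x * ((c • u) x * conj (v x))) =
        fun x => c * (u' x * conj (v' x) - W x * (u x * conj (v x))) := by
      funext x
      simp only [Pi.smul_apply, smul_eq_mul]
      ring
    refine ⟨by rw [hfun]; exact i1.const_mul c, ?_⟩
    rw [hfun, integral_const_mul, e1, ← integral_const_mul]
    refine integral_congr_ae ?_
    filter_upwards [Lp.coeFn_smul c q.2] with x hx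
    simp only [Prod.smul_snd, hx, Pi.smul_apply, smul_eq_mul]
    ring

/-- The Schrödinger operator `-Δ_D - W` in `L₂(Γ)`, defined via its quadratic form. -/
def schrodinger (W : Γ.Point → ℝ) : L2 Γ →ₗ.[ℂ] L2 Γ := (schrodingerGraph W).toLinearPMap

/-- The form `∫ (|u'|² - W |u|²) dx` on `H^{1,0}(Γ)` is finite, bounded below and closed
in `L₂(Γ)`. -/
structure IsClosedSemiboundedForm (W : Γ.Point → ℝ) : Prop where
  integrable : ∀ u u' : Γ.Point → ℂ, MemH10 u u' →
    Integrable (fun x => W x * ‖u x‖ ^ 2) volume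
  bounded_below : ∃ c : ℝ, ∀ u u' : Γ.Point → ℂ, MemH10 u u' →
    c * ∫ x, ‖u x‖ ^ 2 ≤ schrodingerForm W u u'
  closed : ∀ (u u' : ℕ → Γ.Point → ℂ) (f : L2 Γ), (∀ n, MemH10 (u n) (u' n)) →
    Tendsto (fun n => eLpNorm (fun x => u n x - f x) 2 volume) atTop (𝓝 0) →
    Tendsto (fun q : ℕ × ℕ => schrodingerForm W (u q.1 - u q.2) (u' q.1 - u' q.2)) atTop (𝓝 0) →
    ∃ w w' : Γ.Point → ℂ, MemH10 w w' ∧ f =ᵐ[volume] w ∧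
      Tendsto (fun n => schrodingerForm W (u n - w) (u' n - w')) atTop (𝓝 0)

end RegularTree

section Operators

variable {E : Type*} [NormedAddCommGroup E] [InnerProductSpace ℂ E]

/-- The spectrum of an unbounded operator: the complement of the set of all `z` for which `H - z` is
a bijection from the domain of `H` onto the whole space, with bounded inverse. -/
def unboundedSpectrum (H : E →ₗ.[ℂ] E) : Set ℂ :=
  {z | ¬ ∃ R : E →L[ℂ] E,
    (∀ f : E, ∃ h : R f ∈ H.domain, H ⟨R f, h⟩ - z • R f = f) ∧
    ∀ u : H.domain, R (H u - z • (u : E)) = u}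

/-- The eigenspace `ker (H - l)`. -/
def unboundedEigenspace (H : E →ₗ.[ℂ] E) (l : ℝ) : Submodule ℂ E :=
  H.graph.comap (LinearMap.id.prod ((l : ℂ) • LinearMap.id))

/-- `N_-(H)`: the number of negative eigenvalues, counted according to their multiplicities. -/
def negEigenvalueCount (H : E →ₗ.[ℂ] E) : ℝ≥0∞ :=
  ∑' l : Iio (0 : ℝ), ((Module.rank ℂ (unboundedEigenspace H l)).toENat : ℝ≥0∞)

end Operators

namespace RegularTree

variable {Γ : RegularTree}

/-- The form of `-Δ_D - W` is closed and bounded below, and the operator that it defines is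
self-adjoint (with graph as described by the form) and has finite negative spectrum. -/
structure HasFiniteNegativeSpectrum (W : Γ.Point → ℝ) : Prop where
  form : IsClosedSemiboundedForm W
  graph_eq : (schrodinger W).graph = schrodingerGraph W
  selfAdjoint : IsSelfAdjoint (schrodinger W)
  finite : {l : ℝ | l < 0 ∧ (l : ℂ) ∈ unboundedSpectrum (schrodinger W)}.Finite

/-- `N_-(H_{αV})` for `H_{αV} = -Δ_D - αV`. -/
def countNeg (V : Γ.Point → ℝ) (α : ℝ) : ℝ≥0∞ :=
  negEigenvalueCount (schrodinger fun x => α * V x)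

/-- `∫_{V > tΨ} Φ dx` with `Φ(x) = |x| Ψ(x)`. -/
def distribution (Ψ V : Γ.Point → ℝ) (t : ℝ) : ℝ≥0∞ :=
  ∫⁻ x in {x | t * Ψ x < V x}, ENNReal.ofReal (x.height * Ψ x)

end RegularTree

/-- The quasi-norm of the weak space `L_{p,w}(X, μ)`. -/
def weakLpQuasinorm {X : Type*} [MeasurableSpace X] (f : X → ℝ) (p : ℝ) (μ : Measure X) : ℝ≥0∞ :=
  ⨆ (t : ℝ) (_ : 0 < t), ENNReal.ofReal t * μ {x | t < |f x|} ^ (1 / p)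

/-- `f ∈ L_{p,w}(X, μ)`. -/
def MemWeakLp {X : Type*} [MeasurableSpace X] (f : X → ℝ) (p : ℝ) (μ : Measure X) : Prop :=
  AEMeasurable f μ ∧ weakLpQuasinorm f p μ < ∞

end

open RegularTree

noncomputable section

/-! ### Operators given by a bounded self-adjoint resolvent -/

section AbstractOperators

/-! Fix `α` and split `αV = W₁ + W₂` with `W₁ = min (αV) (Ψ/2)` and `W₂ = (αV - Ψ/2)₊`. The
normalized Hardy inequality bounds `∫ W₁|u|²` by half the Dirichlet energy, so wherever the form is
negative `W₂` must carry at least the other half. On a finite-dimensional space on which the form is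
negative, choose a basis `u_j` orthonormal for the Dirichlet inner product. Then `∫ W₂|u_j|² ≥ 1/2`
for each `j`, while `∑ |u_j(x)|² ≤ |x|`, because evaluation at `x` has squared norm at most `|x|` in
the energy norm (`MemH10.enorm_sq_le`, `sum_sq_le_height`). Summing over `j`, the dimension is at
most `2 ∫ |x| W₂ dx` (`IsSplitting.card_le`).

This integral equals `α ∫ (V/Ψ - 1/(2α))₊ Φ dx`, and the layer cake formula turns it into `α` times
the integral over `s > 1/(2α)` of `ν(s) = ∫_{V > sΨ} Φ dx` (`spectral_bounds_of_tail`). A bound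
`ν(s) ≤ M s^(-p)` then gives `2^p/(p-1) · α^p M` (`le_of_tail`). As `α → ∞`, the range of `s` away
from zero contributes only `O(α) = o(α^p)`, so the limsup is governed by `s → 0` alone
(`limsup_le_of_tail`). If `V/Ψ` is in `L_p`, then `s^p ν(s) → 0` as `s → 0` by dominated
convergence.

Finiteness of `∫ |x| W₂ dx` also yields the operator. Truncating `W₂` at a high level shows that the
potential is form bounded with relative bound 3/4 (`IsSplitting.exists_isFormBounded`). The form is
then closed, and coercive after a shift by some `c`. Its operator is `R⁻¹ - c` with `R` bounded,
injective and self-adjoint (`exists_isResolventGraph`). Families of exact or approximate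
eigenvectors with negative spectral parameter span spaces on which the form is negative, so the
dimension bound controls both the eigenvalue count and the size of the negative spectrum
(`negEigenvalueCount_le`, `finite_negative_spectrum`). -/

theorem inner_sum_smul_prod {E : Type*} [NormedAddCommGroup E] [InnerProductSpace ℂ E] {ι : Type*} [Fintype ι] (a : ι → ℂ) (F : ι → E × E) :
    inner ℂ (∑ i, a i • F i).1 (∑ i, a i • F i).2 =
      ∑ i, ∑ j, conj (a i) * a j * inner ℂ (F i).1 (F j).2 := by
  rw [Prod.fst_sum, Prod.snd_sum, sum_inner]
  refine Finset.sum_congr rfl fun i _ => ?_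
  rw [inner_sum]
  refine Finset.sum_congr rfl fun j _ => ?_
  rw [Prod.smul_fst, Prod.smul_snd, inner_smul_left, inner_smul_right]
  ring

variable {E : Type*} [NormedAddCommGroup E] [InnerProductSpace ℂ E] [CompleteSpace E]

/-- Self-adjointness turns `⟨S²x, x⟩` into `‖Sx‖²`, so `S²` is coercive with constant `κ²`, hence
invertible; an element whose square is a unit is a unit. -/
theorem IsSelfAdjoint.isUnit_of_bounded_below {S : E →L[ℂ] E} (hS : IsSelfAdjoint S) {κ : ℝ}
    (hκ : 0 < κ) (h : ∀ x, κ * ‖x‖ ≤ ‖S x‖) : IsUnit S := by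
  have h2 : IsUnit (S * S) := by
    refine ContinuousLinearMap.isUnit_of_forall_le_norm_inner_map _ (c := ⟨κ ^ 2, by positivity⟩)
      (by change (0 : ℝ) < κ ^ 2; positivity) fun x => ?_
    have e : inner ℂ ((S * S) x) x = inner ℂ (S x) (S x) := by
      rw [← ContinuousLinearMap.adjoint_inner_left S, hS.adjoint_eq]; rfl
    rw [e, inner_self_eq_norm_sq_to_K]
    have h1 := h x
    have h3 : (κ * ‖x‖) ^ 2 ≤ ‖S x‖ ^ 2 := by gcongr
    change ‖x‖ ^ 2 * κ ^ 2 ≤ ‖((‖S x‖ : ℝ) : ℂ) ^ 2‖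
    rw [← Complex.ofReal_pow, Complex.norm_real, Real.norm_of_nonneg (by positivity)]
    calc ‖x‖ ^ 2 * κ ^ 2 = (κ * ‖x‖) ^ 2 := by ring
      _ ≤ _ := h3
  exact (isUnit_pow_iff two_ne_zero).1 (by rwa [pow_two])

/-- `G` is the graph of `R⁻¹ - c`, where `R` is bounded, injective and self-adjoint. -/
structure IsResolventGraph (G : Submodule ℂ (E × E)) (R : E →L[ℂ] E) (c : ℝ) : Prop where
  selfAdjoint : IsSelfAdjoint R
  injective : ∀ g, R g = 0 → g = 0
  mem_iff : ∀ f h, (f, h) ∈ G ↔ f = R (h + (c : ℂ) • f)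

namespace IsResolventGraph

variable {G : Submodule ℂ (E × E)} {R : E →L[ℂ] E} {c : ℝ}

theorem snd_eq_zero (hG : IsResolventGraph G R c) (q : E × E) (hq : q ∈ G) (h0 : q.1 = 0) :
    q.2 = 0 := by
  have h := (hG.mem_iff q.1 q.2).1 hq
  rw [h0, smul_zero, add_zero] at h
  exact hG.injective _ h.symm

theorem graph_eq (hG : IsResolventGraph G R c) : G.toLinearPMap.graph = G :=
  Submodule.toLinearPMap_graph_eq G hG.snd_eq_zero

theorem resolvent_mem (hG : IsResolventGraph G R c) (g : E) :
    (R g, g - (c : ℂ) • R g) ∈ G := by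
  rw [hG.mem_iff, sub_add_cancel]

theorem inner_resolvent (hG : IsResolventGraph G R c) (x y : E) :
    inner ℂ (R x) y = inner ℂ x (R y) := by
  conv_lhs => rw [← hG.selfAdjoint.adjoint_eq]
  exact ContinuousLinearMap.adjoint_inner_left _ _ _

theorem symmetric (hG : IsResolventGraph G R c) {q r : E × E} (hq : q ∈ G) (hr : r ∈ G) :
    inner ℂ q.2 r.1 = inner ℂ q.1 r.2 := by
  have h1 := (hG.mem_iff q.1 q.2).1 hq
  have h2 := (hG.mem_iff r.1 r.2).1 hr
  have h3 : inner ℂ (R (q.2 + (c : ℂ) • q.1)) (r.2 + (c : ℂ) • r.1) =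
      inner ℂ (q.2 + (c : ℂ) • q.1) (R (r.2 + (c : ℂ) • r.1)) := hG.inner_resolvent _ _
  rw [← h1, ← h2, inner_add_left, inner_add_right, inner_smul_left, inner_smul_right,
    Complex.conj_ofReal] at h3
  exact (add_right_cancel h3).symm

/-- The domain contains the range of `R`. If `y` is orthogonal to it, then `‖Ry‖² = ⟨R(Ry), y⟩ = 0`,
and injectivity gives `y = 0`. -/
theorem dense_domain (hG : IsResolventGraph G R c) :
    Dense (G.toLinearPMap.domain : Set E) := by
  rw [Submodule.dense_iff_topologicalClosure_eq_top, Submodule.topologicalClosure_eq_top_iff,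
    Submodule.eq_bot_iff]
  intro y hy
  apply hG.injective
  rw [← inner_self_eq_zero (𝕜 := ℂ), ← hG.inner_resolvent]
  refine (Submodule.mem_orthogonal _ _).1 hy _ ?_
  exact ⟨_, hG.resolvent_mem (R y), rfl⟩

/-- Testing the adjoint relation for `(y, z)` on the pairs `(Rg, g - cRg)` and moving `R` across the
inner product gives `y = R(z + cy)`, which is membership in the graph. The other inclusion is
symmetry. -/
theorem isSelfAdjoint (hG : IsResolventGraph G R c) : IsSelfAdjoint G.toLinearPMap := by
  rw [LinearPMap.isSelfAdjoint_def]
  apply LinearPMap.eq_of_eq_graph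
  rw [LinearPMap.adjoint_graph_eq_graph_adjoint hG.dense_domain, hG.graph_eq]
  ext ⟨y, z⟩
  rw [Submodule.mem_adjoint_iff]
  constructor
  · intro h
    rw [hG.mem_iff]
    refine ext_inner_left ℂ fun g => ?_
    have h1 := h _ _ (hG.resolvent_mem g)
    simp only [inner_sub_left, inner_smul_left, Complex.conj_ofReal] at h1
    rw [← hG.inner_resolvent, inner_add_right, inner_smul_right]
    linear_combination h1
  · intro h a b hab
    rw [hG.symmetric hab h, sub_self]

/-- Otherwise `H - l` is bounded below on its domain. Then `(H - l)R = 1 - (c + l)R` is self-adjoint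
and bounded below, hence invertible, and `R` composed with its inverse is a bounded inverse of `H -
l`. -/
theorem exists_approx_eigenvector (hG : IsResolventGraph G R c) {l : ℝ}
    (hl : (l : ℂ) ∈ unboundedSpectrum G.toLinearPMap) {ε : ℝ} (hε : 0 < ε) :
    ∃ q ∈ G, ‖q.1‖ = 1 ∧ ‖q.2 - (l : ℂ) • q.1‖ ≤ ε := by
  by_contra! hcon
  have hb : ∀ q ∈ G, ε * ‖q.1‖ ≤ ‖q.2 - (l : ℂ) • q.1‖ := by
    intro q hq
    rcases eq_or_ne q.1 0 with h0 | h0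
    · rw [h0]; simp
    have hn : ‖q.1‖ ≠ 0 := norm_ne_zero_iff.2 h0
    have h1 := hcon (((‖q.1‖⁻¹ : ℝ) : ℂ) • q) (G.smul_mem _ hq)
      (by simp [norm_smul, hn])
    have h2 : ‖(((‖q.1‖⁻¹ : ℝ) : ℂ) • q).2 - (l : ℂ) • (((‖q.1‖⁻¹ : ℝ) : ℂ) • q).1‖ =
        ‖q.1‖⁻¹ * ‖q.2 - (l : ℂ) • q.1‖ := by
      rw [Prod.smul_snd, Prod.smul_fst, smul_comm, ← smul_sub, norm_smul, Complex.norm_real,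
        norm_inv, norm_norm]
    rw [h2, inv_mul_eq_div, lt_div_iff₀ (by positivity)] at h1
    exact h1.le
  apply hl
  set S : E →L[ℂ] E := 1 - ((c + l : ℝ) : ℂ) • R with hS
  have hSR : ∀ g, S g = (g - (c : ℂ) • R g) - (l : ℂ) • R g := by
    intro g
    have : S g = g - ((c + l : ℝ) : ℂ) • R g := rfl
    rw [this, Complex.ofReal_add, add_smul]
    abel
  have hSsa : IsSelfAdjoint S := by
    refine (IsSelfAdjoint.one _).sub (IsSelfAdjoint.smul ?_ hG.selfAdjoint)
    exact Complex.conj_ofReal _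
  -- The constant comes from `‖g‖ ≤ ‖Sg‖ + |c + l| ‖Rg‖` together with `ε ‖Rg‖ ≤ ‖Sg‖`.
  have hSb : ∀ g, (1 + |c + l| / ε)⁻¹ * ‖g‖ ≤ ‖S g‖ := by
    intro g
    have h1 := hb _ (hG.resolvent_mem g)
    rw [← hSR] at h1
    have h2 : ‖g‖ ≤ ‖S g‖ + |c + l| * ‖R g‖ := by
      have : g = S g + ((c + l : ℝ) : ℂ) • R g := by simp [hS]
      conv_lhs => rw [this]
      refine (norm_add_le _ _).trans ?_
      rw [norm_smul, Complex.norm_real, Real.norm_eq_abs]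
    rw [inv_mul_le_iff₀ (by positivity)]
    have h3 : ‖R g‖ ≤ ‖S g‖ / ε := by rw [le_div_iff₀ hε]; linarith
    calc ‖g‖ ≤ ‖S g‖ + |c + l| * (‖S g‖ / ε) := by
          refine h2.trans ?_; gcongr
      _ = _ := by ring
  obtain ⟨u, hu⟩ := hSsa.isUnit_of_bounded_below (by positivity) hSb
  have hu1 : ∀ x, S ((↑u⁻¹ : E →L[ℂ] E) x) = x := fun x => by
    rw [← hu]; exact DFunLike.congr_fun u.mul_inv x
  have hu2 : ∀ x, (↑u⁻¹ : E →L[ℂ] E) (S x) = x := fun x => by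
    rw [← hu]; exact DFunLike.congr_fun u.inv_mul x
  refine ⟨R ∘L (↑u⁻¹ : E →L[ℂ] E), fun f => ?_, fun v => ?_⟩
  · have hm := hG.resolvent_mem ((↑u⁻¹ : E →L[ℂ] E) f)
    rw [← hG.graph_eq, LinearPMap.mem_graph_iff] at hm
    obtain ⟨w, hw1, hw2⟩ := hm
    simp only at hw1 hw2
    refine ⟨hw1 ▸ w.2, ?_⟩
    have : (⟨(R ∘L (↑u⁻¹ : E →L[ℂ] E)) f, hw1 ▸ w.2⟩ : G.toLinearPMap.domain) = w :=
      Subtype.ext hw1.symm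
    rw [this, hw2]
    change _ - (l : ℂ) • R ((↑u⁻¹ : E →L[ℂ] E) f) = f
    rw [← hSR, hu1]
  · have hm : ((v : E), G.toLinearPMap v) ∈ G :=
      G.mem_graph_toLinearPMap hG.snd_eq_zero v
    have h1 := (hG.mem_iff _ _).1 hm
    set g := G.toLinearPMap v + (c : ℂ) • (v : E) with hg
    have h2 : G.toLinearPMap v - (l : ℂ) • (v : E) = S g := by
      rw [hSR, ← h1, hg]; abel
    rw [h2, ContinuousLinearMap.comp_apply, hu2, ← h1]

/-- The quadratic form of the operator is negative on families in the graph of size at most `N`. -/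
def NegativeFamiliesBounded (G : Submodule ℂ (E × E)) (N : ℝ≥0∞) : Prop :=
  ∀ (ι : Type) [Fintype ι] (F : ι → E × E), (∀ i, F i ∈ G) →
    (∀ a : ι → ℂ, a ≠ 0 →
      (inner ℂ (∑ i, a i • F i).1 (∑ i, a i • F i).2).re < 0) → (Fintype.card ι : ℝ≥0∞) ≤ N

/-- A matrix entrywise `ε`-close to `diag(l)` differs from it as a form by at most `ε (∑ |a_i|)² ≤
mε ∑ |a_i|²` (Cauchy–Schwarz), which diagonal entries below `-mε` outweigh. -/
theorem re_sum_mul_lt_zero {m : ℕ} {ε : ℝ} {l : Fin m → ℝ} {A : Fin m → Fin m → ℂ}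
    (hA : ∀ i j, ‖A i j - (if i = j then (l i : ℂ) else 0)‖ ≤ ε) (hl : ∀ i, l i < - ((m : ℝ) * ε))
    {a : Fin m → ℂ} (ha : a ≠ 0) : (∑ i, ∑ j, conj (a i) * a j * A i j).re < 0 := by
  have e1 : ∑ i, ∑ j, conj (a i) * a j * A i j =
      ∑ i, (((l i * ‖a i‖ ^ 2 : ℝ)) : ℂ) +
        ∑ i, ∑ j, conj (a i) * a j * (A i j - (if i = j then (l i : ℂ) else 0)) := by
    rw [← Finset.sum_add_distrib]
    refine Finset.sum_congr rfl fun i _ => ?_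
    have : (((l i * ‖a i‖ ^ 2 : ℝ)) : ℂ) =
        ∑ j, conj (a i) * a j * (if i = j then (l i : ℂ) else 0) := by
      simp only [mul_ite, mul_zero, Finset.sum_ite_eq, Finset.mem_univ, if_true]
      rw [mul_comm (conj (a i)), Complex.mul_conj, Complex.normSq_eq_norm_sq]
      push_cast; ring
    rw [this, ← Finset.sum_add_distrib]
    refine Finset.sum_congr rfl fun j _ => ?_
    ring
  rw [e1, ← Complex.ofReal_sum, Complex.add_re, Complex.ofReal_re]
  have e2 : (∑ i, ∑ j, conj (a i) * a j * (A i j - (if i = j then (l i : ℂ) else 0))).re ≤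
      ε * (m * ∑ i, ‖a i‖ ^ 2) := by
    refine (Complex.re_le_norm _).trans ?_
    calc _ ≤ ∑ i, ∑ j, ‖a i‖ * ‖a j‖ * ε := by
          refine (norm_sum_le _ _).trans (Finset.sum_le_sum fun i _ => ?_)
          refine (norm_sum_le _ _).trans (Finset.sum_le_sum fun j _ => ?_)
          rw [norm_mul, norm_mul, Complex.norm_conj]
          gcongr
          exact hA i j
      _ = ε * (∑ i, ‖a i‖) ^ 2 := by
          rw [pow_two, Finset.sum_mul_sum, Finset.mul_sum]
          refine Finset.sum_congr rfl fun i _ => ?_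
          rw [Finset.mul_sum]
          refine Finset.sum_congr rfl fun j _ => ?_
          ring
      _ ≤ _ := by
          obtain ⟨i, -⟩ := Function.ne_iff.1 ha
          have hε : 0 ≤ ε := (norm_nonneg _).trans (hA i i)
          gcongr
          have := sq_sum_le_card_mul_sum_sq (s := Finset.univ) (f := fun i => ‖a i‖)
          simpa using this
  have e3 : ∑ i, l i * ‖a i‖ ^ 2 + ε * (m * ∑ i, ‖a i‖ ^ 2) =
      ∑ i, (l i + m * ε) * ‖a i‖ ^ 2 := by
    rw [Finset.mul_sum, Finset.mul_sum, ← Finset.sum_add_distrib]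
    refine Finset.sum_congr rfl fun i _ => ?_
    ring
  have e4 : ∑ i, (l i + m * ε) * ‖a i‖ ^ 2 < 0 := by
    obtain ⟨i, hi⟩ := Function.ne_iff.1 ha
    refine Finset.sum_neg' (fun i _ => ?_) ⟨i, Finset.mem_univ _, ?_⟩
    · exact mul_nonpos_of_nonpos_of_nonneg (by linarith [hl i]) (by positivity)
    · have : 0 < ‖a i‖ := norm_pos_iff.2 hi
      exact mul_neg_of_neg_of_pos (by linarith [hl i]) (by positivity)
  linarith

/-- With infinitely many negative spectral points, take more of them than `N` allows, and an
`ε`-approximate unit eigenvector for each. Symmetry makes vectors for distinct points orthogonal up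
to `O(ε)`, so the matrix of the form is close to a negative diagonal one, and the form is negative
on too large a family. -/
theorem finite_negative_spectrum (hG : IsResolventGraph G R c) {N : ℝ≥0∞} (hN : N ≠ ⊤)
    (hneg : NegativeFamiliesBounded G N) :
    {l : ℝ | l < 0 ∧ (l : ℂ) ∈ unboundedSpectrum G.toLinearPMap}.Finite := by
  by_contra hinf
  obtain ⟨m, hm⟩ := ENNReal.exists_nat_gt hN
  obtain ⟨t, hts, htm⟩ := Set.Infinite.exists_subset_card_eq hinf m
  let l : Fin m → ℝ := fun i => (t.equivFinOfCardEq htm).symm i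
  have hlt : ∀ i, l i ∈ t := fun i => ((t.equivFinOfCardEq htm).symm i).2
  have hinj : Function.Injective l := fun i j h =>
    (t.equivFinOfCardEq htm).symm.injective (Subtype.ext h)
  -- All matrix entries deviate by at most `εK`: off the diagonal the error is `|l_j| · 2ε/|l_j -
  -- l_i| + ε`. The terms with `i = j` vanish, since division by zero gives zero.
  set K : ℝ := 1 + ∑ i, ∑ j, 2 * |l j| / |l j - l i| with hK
  have hKij : ∀ i j, 1 + 2 * |l j| / |l j - l i| ≤ K := by
    intro i j
    rw [hK]
    gcongr
    calc 2 * |l j| / |l j - l i| ≤ ∑ j, 2 * |l j| / |l j - l i| :=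
          Finset.single_le_sum (f := fun j => 2 * |l j| / |l j - l i|)
            (fun _ _ => by positivity) (Finset.mem_univ j)
      _ ≤ _ := Finset.single_le_sum (f := fun i => ∑ j, 2 * |l j| / |l j - l i|)
            (fun _ _ => by positivity) (Finset.mem_univ i)
  have hlim : ∀ i, ∀ᶠ ε : ℝ in 𝓝[>] 0, l i < -((m : ℝ) * (ε * K)) := by
    intro i
    have hc : Tendsto (fun ε : ℝ => -((m : ℝ) * (ε * K))) (𝓝[>] 0) (𝓝 0) := by
      have : Continuous (fun ε : ℝ => -((m : ℝ) * (ε * K))) := by fun_prop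
      have h0 := this.tendsto 0
      simp only [zero_mul, mul_zero, neg_zero] at h0
      exact h0.mono_left nhdsWithin_le_nhds
    exact hc.eventually (lt_mem_nhds (hts (hlt i)).1)
  obtain ⟨ε, hε, hε0⟩ := ((eventually_all.2 hlim).and self_mem_nhdsWithin).exists
  replace hε0 : 0 < ε := hε0
  choose F hF hF1 hF2 using fun i =>
    hG.exists_approx_eigenvector (hts (hlt i)).2 hε0
  have key := hneg (Fin m) F hF ?_
  · rw [Fintype.card_fin] at key
    exact absurd hm (not_lt.2 key)
  intro a ha
  rw [inner_sum_smul_prod]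
  refine re_sum_mul_lt_zero (ε := ε * K) (l := l) (fun i j => ?_) hε ha
  have hr : ∀ i j, ‖inner ℂ (F i).1 ((F j).2 - (l j : ℂ) • (F j).1)‖ ≤ ε := fun i j =>
    (norm_inner_le_norm _ _).trans (by rw [hF1, one_mul]; exact hF2 j)
  have hr' : ∀ i j, ‖inner ℂ ((F i).2 - (l i : ℂ) • (F i).1) (F j).1‖ ≤ ε := fun i j => by
    rw [norm_inner_symm]; exact hr j i
  have he : ∀ i j, inner ℂ (F i).1 (F j).2 = (l j : ℂ) * inner ℂ (F i).1 (F j).1 +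
      inner ℂ (F i).1 ((F j).2 - (l j : ℂ) • (F j).1) := fun i j => by
    rw [inner_sub_right, inner_smul_right]; ring
  have he' : ∀ i j, inner ℂ (F i).2 (F j).1 = (l i : ℂ) * inner ℂ (F i).1 (F j).1 +
      inner ℂ ((F i).2 - (l i : ℂ) • (F i).1) (F j).1 := fun i j => by
    rw [inner_sub_left, inner_smul_left, Complex.conj_ofReal]; ring
  split_ifs with hij
  · subst hij
    rw [he, inner_self_eq_norm_sq_to_K, hF1]
    simp only [RCLike.ofReal_one, one_pow, mul_one, add_sub_cancel_left]
    refine (hr i i).trans (le_mul_of_one_le_right hε0.le ?_)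
    have := hKij i i
    simp only [sub_self, abs_zero, div_zero, add_zero] at this
    exact this
  · rw [sub_zero]
    have hd : 0 < |l j - l i| := abs_pos.2 (sub_ne_zero.2 fun h => hij (hinj h).symm)
    -- Almost-orthogonality: subtracting the two expressions for the symmetric form leaves only the
    -- two residuals.
    have h1 : ((l j - l i : ℝ) : ℂ) * inner ℂ (F i).1 (F j).1 =
        inner ℂ ((F i).2 - (l i : ℂ) • (F i).1) (F j).1 -
          inner ℂ (F i).1 ((F j).2 - (l j : ℂ) • (F j).1) := by
      have := hG.symmetric (hF i) (hF j)
      rw [he, he'] at this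
      push_cast
      linear_combination -this
    have h2 : |l j - l i| * ‖(inner ℂ (F i).1 (F j).1 : ℂ)‖ ≤ 2 * ε := by
      rw [← Real.norm_eq_abs, ← Complex.norm_real, ← norm_mul, h1]
      refine (norm_sub_le _ _).trans ?_
      linarith [hr' i j, hr i j]
    rw [he]
    refine (norm_add_le _ _).trans ?_
    rw [norm_mul, Complex.norm_real, Real.norm_eq_abs]
    have h3 : ‖(inner ℂ (F i).1 (F j).1 : ℂ)‖ ≤ 2 * ε / |l j - l i| := by
      rw [le_div_iff₀ hd]; linarith
    calc |l j| * ‖(inner ℂ (F i).1 (F j).1 : ℂ)‖ + _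
        ≤ |l j| * (2 * ε / |l j - l i|) + ε := add_le_add (by gcongr) (hr i j)
      _ = ε * (1 + 2 * |l j| / |l j - l i|) := by ring
      _ ≤ ε * K := by gcongr; exact hKij i j

theorem mem_eigenspace_iff (hG : IsResolventGraph G R c) (l : ℝ) (f : E) :
    f ∈ unboundedEigenspace G.toLinearPMap l ↔ (f, (l : ℂ) • f) ∈ G := by
  unfold unboundedEigenspace
  rw [hG.graph_eq]
  rfl

theorem inner_eq_zero_of_mem_eigenspace (hG : IsResolventGraph G R c) {l m : ℝ} (hlm : l ≠ m)
    {f g : E} (hf : (f, (l : ℂ) • f) ∈ G) (hg : (g, (m : ℂ) • g) ∈ G) : inner ℂ f g = 0 := by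
  have h := hG.symmetric hf hg
  simp only [inner_smul_left, inner_smul_right, Complex.conj_ofReal] at h
  have h1 : ((l - m : ℝ) : ℂ) * inner ℂ f g = 0 := by push_cast; linear_combination h
  rcases mul_eq_zero.1 h1 with h2 | h2
  · exact absurd (sub_eq_zero.1 (Complex.ofReal_eq_zero.1 h2)) hlm
  · exact h2

/-- Eigenspaces are mutually orthogonal, so for a combination with components `g_l` the form is `∑ l
‖g_l‖² < 0`; some `g_l` is nonzero by linear independence. The numbers `k l` only bound the ranks
from below, since the ranks are not yet known to be finite. -/
theorem sum_card_le (hG : IsResolventGraph G R c) {N : ℝ≥0∞}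
    (hneg : NegativeFamiliesBounded G N) (s : Finset (Iio (0 : ℝ))) (k : Iio (0 : ℝ) → ℕ)
    (hk : ∀ l ∈ s, (k l : Cardinal) ≤
      Module.rank ℂ (unboundedEigenspace G.toLinearPMap l)) :
    ∑ l ∈ s, (k l : ℝ≥0∞) ≤ N := by
  have hfam : ∀ l : s, ∃ f : Fin (k l) → E, LinearIndependent ℂ f ∧
      ∀ i, (f i, (((l : Iio (0 : ℝ)) : ℝ) : ℂ) • f i) ∈ G := by
    intro l
    obtain ⟨f, hf⟩ := Module.le_rank_iff.1 (hk l l.2)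
    refine ⟨fun i => (f i : E), hf.map' (Submodule.subtype _) (Submodule.ker_subtype _),
      fun i => ?_⟩
    exact (hG.mem_eigenspace_iff _ _).1 (f i).2
  choose f hfi hfG using hfam
  let F : (Σ l : s, Fin (k l)) → E × E := fun q =>
    (f q.1 q.2, (((q.1 : Iio (0 : ℝ)) : ℝ) : ℂ) • f q.1 q.2)
  have key := hneg (Σ l : s, Fin (k l)) F (fun q => hfG q.1 q.2) ?_
  · rw [Fintype.card_sigma] at key
    simp only [Fintype.card_fin] at key
    rw [← Finset.sum_coe_sort, ← Nat.cast_sum]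
    exact key
  intro a ha
  let g : s → E := fun l => ∑ i, a ⟨l, i⟩ • f l i
  let Q : s → E × E := fun l => (g l, (((l : Iio (0 : ℝ)) : ℝ) : ℂ) • g l)
  have hQ : ∀ l, Q l = ∑ i, a ⟨l, i⟩ • F ⟨l, i⟩ := by
    intro l
    refine Prod.ext ?_ ?_
    · rw [Prod.fst_sum]; rfl
    · rw [Prod.snd_sum]
      change (((l : Iio (0 : ℝ)) : ℝ) : ℂ) • (∑ i, a ⟨l, i⟩ • f l i) = _
      rw [Finset.smul_sum]
      exact Finset.sum_congr rfl fun i _ => smul_comm _ _ _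
  have hQG : ∀ l, Q l ∈ G := fun l => by
    rw [hQ]
    exact G.sum_mem fun i _ => G.smul_mem _ (hfG l i)
  have hsum : ∑ q, a q • F q = ∑ l, (1 : ℂ) • Q l := by
    rw [Fintype.sum_sigma]
    exact Finset.sum_congr rfl fun l _ => by rw [hQ, one_smul]
  rw [hsum, inner_sum_smul_prod]
  have hdiag : ∀ l, ∑ m, conj (1 : ℂ) * 1 * inner ℂ (Q l).1 (Q m).2 =
      (((l : Iio (0 : ℝ)) : ℝ) * ‖g l‖ ^ 2 : ℝ) := by
    intro l
    rw [Finset.sum_eq_single l]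
    · change conj (1 : ℂ) * 1 * inner ℂ (g l) ((((l : Iio (0 : ℝ)) : ℝ) : ℂ) • g l) = _
      rw [inner_smul_right, inner_self_eq_norm_sq_to_K]
      simp
    · intro m _ hm
      have h0 : inner ℂ (g l) (g m) = 0 := by
        refine hG.inner_eq_zero_of_mem_eigenspace (fun h => hm ?_) (hQG l) (hQG m)
        exact (Subtype.ext (Subtype.ext h)).symm
      change conj (1 : ℂ) * 1 * inner ℂ (g l) ((((m : Iio (0 : ℝ)) : ℝ) : ℂ) • g m) = _
      rw [inner_smul_right, h0, mul_zero, mul_zero]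
    · intro h; exact absurd (Finset.mem_univ l) h
  rw [Finset.sum_congr rfl fun l _ => hdiag l, ← Complex.ofReal_sum, Complex.ofReal_re]
  obtain ⟨⟨l, i⟩, hq⟩ := Function.ne_iff.1 ha
  refine Finset.sum_neg' (fun l _ => ?_) ⟨l, Finset.mem_univ _, ?_⟩
  · exact mul_nonpos_of_nonpos_of_nonneg (le_of_lt l.1.2) (by positivity)
  · refine mul_neg_of_neg_of_pos l.1.2 (pow_pos (norm_pos_iff.2 fun h0 => hq ?_) 2)
    exact Fintype.linearIndependent_iff.1 (hfi l) _ h0 i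

theorem negEigenvalueCount_le (hG : IsResolventGraph G R c) {N : ℝ≥0∞}
    (hneg : NegativeFamiliesBounded G N) : negEigenvalueCount G.toLinearPMap ≤ N := by
  rcases eq_or_ne N ⊤ with rfl | hN
  · exact le_top
  have hfin : ∀ l : Iio (0 : ℝ),
      (Module.rank ℂ (unboundedEigenspace G.toLinearPMap l)).toENat ≠ ⊤ := by
    intro l htop
    -- An infinite-dimensional eigenspace would contain independent families of any size, in
    -- particular larger than `N`.
    obtain ⟨m, hm⟩ := ENNReal.exists_nat_gt hN
    have := hG.sum_card_le hneg {l} (fun _ => m) (fun l' hl' => by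
      rw [Finset.mem_singleton.1 hl', ← Cardinal.natCast_le_toENat, htop]
      exact le_top)
    rw [Finset.sum_singleton] at this
    exact absurd hm (not_lt.2 this)
  unfold negEigenvalueCount
  rw [ENNReal.tsum_eq_iSup_sum]
  refine iSup_le fun s => ?_
  have hcast : ∀ l : Iio (0 : ℝ),
      (((Module.rank ℂ (unboundedEigenspace G.toLinearPMap l)).toENat.toNat : ℕ) : ℕ∞) =
        (Module.rank ℂ (unboundedEigenspace G.toLinearPMap l)).toENat :=
    fun l => ENat.natCast_toNat (hfin l)
  refine le_trans (le_of_eq (Finset.sum_congr rfl fun l _ => ?_)) (hG.sum_card_le hneg s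
    (fun l => (Module.rank ℂ (unboundedEigenspace G.toLinearPMap l)).toENat.toNat)
    fun l _ => ?_)
  · conv_lhs => rw [← hcast l]
    exact ENat.toENNReal_coe _
  · rw [← Cardinal.natCast_le_toENat, hcast]

end IsResolventGraph

/-- The graph of the operator associated with the form `‖D u‖² - ‖M u‖²`, when the form domain is
embedded by `J`. -/
def formGraph {K : Type*} [NormedAddCommGroup K] [InnerProductSpace ℂ K] (J D M : K →L[ℂ] E) :
    Set (E × E) :=
  {q | ∃ u : K, q.1 = J u ∧ ∀ v : K,
    inner ℂ (D v) (D u) - inner ℂ (M v) (M u) = inner ℂ (J v) q.2}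

/-- The shifted form is represented on `K` by a self-adjoint operator `A`, invertible by coercivity.
The weak equation for `u` reads `Au = J*(h + cJu)`, so `R = J A⁻¹ J*`. Dense range of `J` makes `J*`
injective, and with injectivity of `J` this makes `R` injective. -/
theorem exists_isResolventGraph {K : Type*} [NormedAddCommGroup K] [InnerProductSpace ℂ K]
    [CompleteSpace K] (J D M : K →L[ℂ] E) (hJ : DenseRange J) (hJi : Function.Injective J)
    {c δ : ℝ} (hδ : 0 < δ)
    (hcoer : ∀ u, δ * ‖u‖ ^ 2 ≤ ‖D u‖ ^ 2 - ‖M u‖ ^ 2 + c * ‖J u‖ ^ 2)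
    (G : Submodule ℂ (E × E)) (hG : (G : Set (E × E)) = formGraph J D M) :
    ∃ R : E →L[ℂ] E, IsResolventGraph G R c := by
  let A : K →L[ℂ] K := D.adjoint ∘L D - M.adjoint ∘L M + (c : ℂ) • (J.adjoint ∘L J)
  have hA : ∀ u v, inner ℂ v (A u) = inner ℂ (D v) (D u) - inner ℂ (M v) (M u) +
      (c : ℂ) * inner ℂ (J v) (J u) := by
    intro u v
    change inner ℂ v (D.adjoint (D u) - M.adjoint (M u) + (c : ℂ) • J.adjoint (J u)) = _
    rw [inner_add_right, inner_sub_right, inner_smul_right]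
    simp only [ContinuousLinearMap.adjoint_inner_right]
  have hAu : ∀ u, (‖D u‖ ^ 2 - ‖M u‖ ^ 2 + c * ‖J u‖ ^ 2 : ℝ) = (inner ℂ u (A u)).re := by
    intro u
    have : inner ℂ u (A u) = ((‖D u‖ ^ 2 - ‖M u‖ ^ 2 + c * ‖J u‖ ^ 2 : ℝ) : ℂ) := by
      rw [hA]
      simp only [inner_self_eq_norm_sq_to_K]
      push_cast
      rfl
    rw [this, Complex.ofReal_re]
  have hAsa : IsSelfAdjoint A := by
    rw [ContinuousLinearMap.isSelfAdjoint_iff']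
    refine ContinuousLinearMap.ext fun u => ext_inner_left ℂ fun v => ?_
    rw [ContinuousLinearMap.adjoint_inner_right, hA, ← inner_conj_symm, hA]
    simp only [map_add, map_sub, map_mul, Complex.conj_ofReal, inner_conj_symm]
  have hAb : ∀ u, δ * ‖u‖ ≤ ‖A u‖ := by
    intro u
    rcases eq_or_ne u 0 with rfl | hu
    · simp
    have hn : 0 < ‖u‖ := norm_pos_iff.2 hu
    have h1 : δ * ‖u‖ ^ 2 ≤ ‖u‖ * ‖A u‖ := by
      refine (hcoer u).trans ?_
      rw [hAu]
      exact (Complex.re_le_norm _).trans (norm_inner_le_norm _ _)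
    nlinarith
  obtain ⟨a, ha⟩ := hAsa.isUnit_of_bounded_below hδ hAb
  let B : K →L[ℂ] K := ↑a⁻¹
  have hAB : ∀ x, A (B x) = x := fun x => by
    rw [← ha]; exact DFunLike.congr_fun a.mul_inv x
  have hBA : ∀ x, B (A x) = x := fun x => by
    rw [← ha]; exact DFunLike.congr_fun a.inv_mul x
  have hJinj : ∀ h, J.adjoint h = 0 → h = 0 := by
    intro h h0
    refine hJ.eq_zero_of_inner_right ℂ fun x => ?_
    rw [← ContinuousLinearMap.adjoint_inner_right J, h0, inner_zero_right]
  refine ⟨J ∘L B ∘L J.adjoint, ?_, fun g hg => ?_, fun f h => ?_⟩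
  · rw [ContinuousLinearMap.isSelfAdjoint_iff']
    refine ContinuousLinearMap.ext fun u => ext_inner_left ℂ fun v => ?_
    rw [ContinuousLinearMap.adjoint_inner_right]
    change inner ℂ (J (B (J.adjoint v))) u = inner ℂ v (J (B (J.adjoint u)))
    rw [← ContinuousLinearMap.adjoint_inner_right J, ← ContinuousLinearMap.adjoint_inner_left J]
    calc inner ℂ (B (J.adjoint v)) (J.adjoint u)
        = inner ℂ (B (J.adjoint v)) (A (B (J.adjoint u))) := by rw [hAB]
      _ = inner ℂ (A (B (J.adjoint v))) (B (J.adjoint u)) := by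
          rw [← ContinuousLinearMap.adjoint_inner_left A, hAsa.adjoint_eq]
      _ = _ := by rw [hAB]
  · have h1 : B (J.adjoint g) = 0 := hJi (by rw [map_zero]; exact hg)
    apply hJinj
    rw [← hAB (J.adjoint g), h1, map_zero]
  · have hmem : (f, h) ∈ G ↔ (f, h) ∈ formGraph J D M := by rw [← hG]; rfl
    have hweak : ∀ u, (∀ v, inner ℂ (D v) (D u) - inner ℂ (M v) (M u) = inner ℂ (J v) h) ↔
        A u = J.adjoint (h + (c : ℂ) • J u) := by
      intro u
      constructor
      · intro hv
        refine ext_inner_left ℂ fun v => ?_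
        rw [hA, hv, ContinuousLinearMap.adjoint_inner_right, inner_add_right, inner_smul_right]
      · intro hv v
        have h1 := hA u v
        rw [hv, ContinuousLinearMap.adjoint_inner_right, inner_add_right, inner_smul_right] at h1
        exact (add_right_cancel h1).symm
    rw [hmem]
    constructor
    · rintro ⟨u, hu, hv⟩
      simp only at hu hv
      change f = J (B (J.adjoint (h + (c : ℂ) • f)))
      rw [hu, ← (hweak u).1 hv, hBA]
    · intro hf
      replace hf : f = J (B (J.adjoint (h + (c : ℂ) • f))) := hf
      refine ⟨B (J.adjoint (h + (c : ℂ) • f)), hf, (hweak _).2 ?_⟩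
      rw [hAB, ← hf]

end AbstractOperators

/-! ### From negativity of the form to bounds for the operator -/

section FormGraph

variable {E : Type*} [NormedAddCommGroup E] [InnerProductSpace ℂ E]

theorem inner_re_of_mem_formGraph {K : Type*} [NormedAddCommGroup K] [InnerProductSpace ℂ K]
    {J D M : K →L[ℂ] E} {u : K} {h : E}
    (hu : ∀ v, inner ℂ (D v) (D u) - inner ℂ (M v) (M u) = inner ℂ (J v) h) :
    (inner ℂ (J u) h).re = ‖D u‖ ^ 2 - ‖M u‖ ^ 2 := by
  rw [← hu u]
  simp only [inner_self_eq_norm_sq_to_K, Complex.sub_re]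
  norm_cast

/-- A bound on the size of families on whose span the form is negative is a bound for the
operator. -/
theorem negativeFamiliesBounded_of_form {K : Type*} [NormedAddCommGroup K]
    [InnerProductSpace ℂ K] {J D M : K →L[ℂ] E} {G : Submodule ℂ (E × E)}
    (hG : (G : Set (E × E)) = formGraph J D M) {N : ℝ≥0∞}
    (hN : ∀ (ι : Type) [Fintype ι] (k : ι → K),
      (∀ a : ι → ℂ, a ≠ 0 → ‖D (∑ i, a i • k i)‖ ^ 2 < ‖M (∑ i, a i • k i)‖ ^ 2) →
        (Fintype.card ι : ℝ≥0∞) ≤ N) :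
    IsResolventGraph.NegativeFamiliesBounded G N := by
  intro ι _ F hF hneg
  have hF' : ∀ i, F i ∈ formGraph J D M := fun i => by rw [← hG]; exact hF i
  choose k hk1 hk2 using hF'
  refine hN ι k fun a ha => ?_
  have h1 := hneg a ha
  have e1 : (∑ i, a i • F i).1 = J (∑ i, a i • k i) := by
    rw [Prod.fst_sum, map_sum]
    exact Finset.sum_congr rfl fun i _ => by rw [Prod.smul_fst, hk1, map_smul]
  have e2 : ∀ v, inner ℂ (D v) (D (∑ i, a i • k i)) - inner ℂ (M v) (M (∑ i, a i • k i)) =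
      inner ℂ (J v) (∑ i, a i • F i).2 := by
    intro v
    simp only [map_sum, map_smul, inner_sum, Prod.snd_sum, Prod.smul_snd, inner_smul_right]
    rw [← Finset.sum_sub_distrib]
    refine Finset.sum_congr rfl fun i _ => ?_
    rw [← hk2, mul_sub]
  rw [e1, inner_re_of_mem_formGraph e2] at h1
  linarith

end FormGraph
end

/-! ### Calculus on the tree and the pointwise estimate -/

noncomputable section

namespace RegularTree

variable {Γ : RegularTree}

instance : Countable Γ.Edge := inferInstance

theorem volume_eq_sum : (volume : Measure Γ.Point) = Measure.sum fun e : Γ.Edge =>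
    ((volume : Measure ℝ).restrict (Γ.edgeInterval e)).map (onEdge e) := rfl

theorem lintegral_eq_tsum {f : Γ.Point → ℝ≥0∞} (hf : AEMeasurable f volume) :
    ∫⁻ x, f x = ∑' e : Γ.Edge, ∫⁻ s in Γ.edgeInterval e, f (onEdge e s) := by
  rw [volume_eq_sum, lintegral_sum_measure]
  refine tsum_congr fun e => ?_
  exact lintegral_map' (hf.mono_measure (map_onEdge_le e)) (aemeasurable_onEdge e)

theorem height_onEdge {e : Γ.Edge} {s : ℝ} (h : s ∈ Γ.edgeInterval e) :
    (onEdge e s).height = s := by rw [onEdge_of_mem h]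

theorem edge_onEdge (e : Γ.Edge) (s : ℝ) : (onEdge e s).edge = e := by
  unfold onEdge
  split_ifs <;> rfl

theorem level_nonneg (n : ℕ) : 0 ≤ Γ.level n := by
  rw [← Γ.level_zero]; exact Γ.level_strictMono.monotone (Nat.zero_le n)

theorem Point.height_nonneg (x : Γ.Point) : 0 ≤ x.height :=
  (level_nonneg _).trans x.level_le

theorem dist_eq (x y : Γ.Point) : dist x y = x.height + y.height - 2 * meetHeight x y := rfl

theorem dist_of_le {x y : Γ.Point} (h : x ≤ y) : dist x y = y.height - x.height := by
  have h1 := Point.meetHeight_le x y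
  have h2 := Point.le_meetHeight (Point.le_refl' x) h
  rw [dist_eq]
  linarith

theorem abs_height_sub_le (x y : Γ.Point) : |x.height - y.height| ≤ dist x y := by
  have h1 := Point.meetHeight_le x y
  have h2 := Point.meetHeight_le y x
  rw [Point.meetHeight_comm] at h2
  rw [dist_eq, abs_le]
  constructor <;> linarith

theorem continuous_height : Continuous (Point.height : Γ.Point → ℝ) := by
  refine continuous_iff_continuousAt.2 fun x => ?_
  rw [Metric.continuousAt_iff]
  exact fun ε hε => ⟨ε, hε, fun {y} hy => (abs_height_sub_le y x).trans_lt hy⟩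

theorem measurable_height : Measurable (Point.height : Γ.Point → ℝ) :=
  continuous_height.measurable

/-- On each of the countably many edges the height is the coordinate, so null sets of heights pull
back to null sets. This carries measurability of `ψ` and almost everywhere statements from the
half-line to the tree. -/
theorem quasiMeasurePreserving_height : Measure.QuasiMeasurePreserving
    (Point.height : Γ.Point → ℝ) volume (volume.restrict (Ioi 0)) := by
  refine ⟨measurable_height, Measure.AbsolutelyContinuous.mk fun t ht ht0 => ?_⟩
  rw [Measure.map_apply measurable_height ht, volume_eq_sum,
    Measure.sum_apply_of_countable, ENNReal.tsum_eq_zero]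
  intro e
  rw [Measure.map_apply_of_aemeasurable (aemeasurable_onEdge e) (measurable_height ht)]
  have hsub : Γ.edgeInterval e ⊆ Ioi 0 := fun s hs => (level_nonneg _).trans_lt hs.1
  refine measure_mono_null_ae ?_ (Measure.restrict_mono_set volume hsub |>.absolutelyContinuous ht0)
  filter_upwards [ae_restrict_mem measurableSet_Ioc] with s hs hst
  have h1 : (onEdge e s).height ∈ t := hst
  rwa [height_onEdge hs] at h1

theorem ae_height_pos : ∀ᵐ x : Γ.Point, 0 < x.height := by
  have := (quasiMeasurePreserving_height (Γ := Γ)).ae (p := fun s => 0 < s)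
    (ae_restrict_mem measurableSet_Ioi)
  exact this

theorem level_lt_succ (n : ℕ) : Γ.level n < Γ.level (n + 1) :=
  Γ.level_strictMono (Nat.lt_succ_self n)

theorem level_succ_mem (e : Γ.Edge) : Γ.level (e.1 + 1) ∈ Γ.edgeInterval e :=
  ⟨level_lt_succ _, le_rfl⟩

/-- The lower end of an edge. -/
def start : Γ.Edge → Γ.Point
  | ⟨0, _⟩ => Γ.root
  | ⟨n + 1, p⟩ => onEdge ⟨n, fun i => p i.castSucc⟩ (Γ.level (n + 1))

theorem height_start (e : Γ.Edge) : (start e).height = Γ.level e.1 := by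
  obtain ⟨n, p⟩ := e
  cases n with
  | zero => exact Γ.level_zero.symm
  | succ n => exact height_onEdge (e := ⟨n, fun i => p i.castSucc⟩) (level_succ_mem _)

theorem start_le_onEdge {e : Γ.Edge} {a : ℝ} (ha : a ∈ Γ.edgeInterval e) :
    start e ≤ onEdge e a := by
  obtain ⟨n, p⟩ := e
  cases n with
  | zero => exact Point.root_le _
  | succ n =>
    rw [onEdge_of_mem ha]
    change onEdge ⟨n, fun i => p i.castSucc⟩ (Γ.level (n + 1)) ≤ _
    rw [onEdge_of_mem (e := ⟨n, fun i => p i.castSucc⟩) (level_succ_mem _)]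
    exact ⟨ha.1.le, Nat.le_succ n, fun i => rfl⟩

theorem dist_start_onEdge {e : Γ.Edge} {a : ℝ} (ha : a ∈ Γ.edgeInterval e) :
    dist (start e) (onEdge e a) = a - Γ.level e.1 := by
  rw [dist_of_le (start_le_onEdge ha), height_onEdge ha, height_start]

theorem tendsto_onEdge_start (e : Γ.Edge) :
    Tendsto (onEdge e) (𝓝[>] Γ.level e.1) (𝓝 (start e)) := by
  rw [tendsto_iff_dist_tendsto_zero]
  have h : Tendsto (fun a : ℝ => a - Γ.level e.1) (𝓝[>] Γ.level e.1) (𝓝 0) := by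
    have : Continuous (fun a : ℝ => a - Γ.level e.1) := by fun_prop
    have h0 := this.tendsto (Γ.level e.1)
    rw [sub_self] at h0
    exact h0.mono_left nhdsWithin_le_nhds
  refine h.congr' ?_
  filter_upwards [Ioc_mem_nhdsGT (level_lt_succ e.1)] with a ha
  rw [dist_comm, dist_start_onEdge ha]

theorem memLp_onEdge {g : Γ.Point → ℂ} (hg : MemLp g 2 volume) (e : Γ.Edge) :
    MemLp (fun s => g (onEdge e s)) 2 ((volume : Measure ℝ).restrict (Γ.edgeInterval e)) := by
  have h1 := hg.mono_measure (map_onEdge_le e)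
  exact (memLp_map_measure_iff h1.aestronglyMeasurable (aemeasurable_onEdge e)).1 h1

/-- Edges do not contain their lower end, so the formula there is a limit: `u` is continuous on the
tree and the primitive of `u'` is continuous up to the end. -/
theorem MemH1.sub_start_eq_integral {u u' : Γ.Point → ℂ} (hu : MemH1 u u') {e : Γ.Edge} {s : ℝ}
    (hs : s ∈ Γ.edgeInterval e) :
    u (onEdge e s) - u (start e) = ∫ r in (Γ.level e.1)..s, u' (onEdge e r) := by
  have h1 : Tendsto (fun a => u (onEdge e s) - u (onEdge e a)) (𝓝[>] Γ.level e.1)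
      (𝓝 (u (onEdge e s) - u (start e))) :=
    tendsto_const_nhds.sub ((hu.continuous.tendsto _).comp (tendsto_onEdge_start e))
  have hint : IntegrableOn (fun r => u' (onEdge e r)) (Γ.edgeInterval e) volume :=
    (memLp_onEdge hu.memLp_deriv e).integrable one_le_two
  have hint' : IntegrableOn (fun r => u' (onEdge e r)) (uIcc (Γ.level e.1) s) volume := by
    rw [uIcc_of_le hs.1.le, integrableOn_Icc_iff_integrableOn_Ioc]
    exact hint.mono_set (Ioc_subset_Ioc_right hs.2)
  have hc := intervalIntegral.continuousOn_primitive_interval_left hint'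
  have h2 : Tendsto (fun a => ∫ r in a..s, u' (onEdge e r)) (𝓝[>] Γ.level e.1)
      (𝓝 (∫ r in (Γ.level e.1)..s, u' (onEdge e r))) := by
    refine (hc (Γ.level e.1) left_mem_uIcc).tendsto.mono_left ?_
    rw [uIcc_of_le hs.1.le]
    refine nhdsWithin_le_iff.2 ?_
    filter_upwards [Ioc_mem_nhdsGT hs.1] with a ha using Ioc_subset_Icc_self ha
  refine tendsto_nhds_unique (h1.congr' ?_) h2
  filter_upwards [Ioc_mem_nhdsGT (level_lt_succ e.1)] with a ha
  exact hu.sub_eq_integral e a ha s hs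

/-- Cauchy–Schwarz, as a comparison of the `L¹` and `L²` norms on an interval of length `b - a`. -/
theorem enorm_integral_sq_le {g : ℝ → ℂ} {a b : ℝ} (hab : a ≤ b)
    (hg : AEStronglyMeasurable g (volume.restrict (Ioc a b))) :
    ‖∫ s in a..b, g s‖ₑ ^ 2 ≤ ENNReal.ofReal (b - a) * ∫⁻ s in Ioc a b, ‖g s‖ₑ ^ 2 := by
  rw [intervalIntegral.integral_of_le hab]
  have h1 : ‖∫ s in Ioc a b, g s‖ₑ ≤ eLpNorm g 1 (volume.restrict (Ioc a b)) := by
    rw [eLpNorm_one_eq_lintegral_enorm]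
    exact enorm_integral_le_lintegral_enorm _
  have h2 := eLpNorm_le_eLpNorm_mul_rpow_measure_univ (one_le_two : (1 : ℝ≥0∞) ≤ 2) hg
  have h3 : (volume.restrict (Ioc a b)) univ = ENNReal.ofReal (b - a) := by simp
  rw [h3] at h2
  calc _ ≤ (eLpNorm g 2 (volume.restrict (Ioc a b)) *
        ENNReal.ofReal (b - a) ^ (1 / (1 : ℝ≥0∞).toReal - 1 / (2 : ℝ≥0∞).toReal)) ^ 2 := by
        gcongr; exact h1.trans h2
    _ = _ := by
      rw [mul_pow, mul_comm]
      congr 1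
      · rw [← ENNReal.rpow_natCast, ← ENNReal.rpow_mul]
        norm_num
      · rw [eLpNorm_eq_lintegral_rpow_enorm_toReal two_ne_zero ENNReal.ofNat_ne_top,
          ← ENNReal.rpow_natCast, ← ENNReal.rpow_mul]
        norm_num

/-- Cauchy–Schwarz for joining two pieces of a path, with lengths `a`, `b` and energies `D`, `E`.
The cross term obeys `4x²y² ≤ 4aDbE ≤ (aE + bD)²`. -/
theorem sq_add_le_of_sq_le {x y a b D E : ℝ} (ha : 0 ≤ a) (hb : 0 ≤ b) (hD : 0 ≤ D)
    (hE : 0 ≤ E) (h1 : x ^ 2 ≤ a * D) (h2 : y ^ 2 ≤ b * E) :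
    (x + y) ^ 2 ≤ (a + b) * (D + E) := by
  have h3 : 2 * (x * y) ≤ a * E + b * D := by
    refine (le_abs_self _).trans (abs_le_of_sq_le_sq ?_ (by positivity))
    have : x ^ 2 * y ^ 2 ≤ (a * D) * (b * E) := by gcongr
    nlinarith [sq_nonneg (a * E - b * D)]
  nlinarith

/-- The Dirichlet energy of an edge. -/
def edgeEnergy (u' : Γ.Point → ℂ) (e : Γ.Edge) : ℝ≥0∞ :=
  ∫⁻ s in Γ.edgeInterval e, ‖u' (onEdge e s)‖ₑ ^ 2

theorem lintegral_sq_lt_top {g : Γ.Point → ℂ} (hg : MemLp g 2 volume) :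
    ∫⁻ x, ‖g x‖ₑ ^ 2 < ∞ := by
  have := lintegral_rpow_enorm_lt_top_of_eLpNorm_lt_top two_ne_zero ENNReal.ofNat_ne_top hg.2
  simpa using this

theorem lintegral_sq_eq_tsum {g : Γ.Point → ℂ} (hg : MemLp g 2 volume) :
    ∫⁻ x, ‖g x‖ₑ ^ 2 = ∑' e, edgeEnergy g e :=
  lintegral_eq_tsum (hg.1.enorm.pow_const 2)

theorem edgeEnergy_ne_top {g : Γ.Point → ℂ} (hg : MemLp g 2 volume) (e : Γ.Edge) :
    edgeEnergy g e ≠ ∞ := by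
  refine ne_top_of_le_ne_top (lintegral_sq_lt_top hg).ne ?_
  rw [lintegral_sq_eq_tsum hg]
  exact ENNReal.le_tsum e

/-- Induction along the path from the root: each new edge adds its length and its energy. The set
`S` collects the edges of the path, and the bound on their generations ensures that the next edge is
not already counted. -/
theorem MemH10.exists_edges {u u' : Γ.Point → ℂ} (hu : MemH10 u u') (n : ℕ) :
    ∀ e : Γ.Edge, e.1 = n → ∀ s ∈ Γ.edgeInterval e, ∃ S : Finset Γ.Edge, (∀ f ∈ S, f.1 ≤ n) ∧
      ‖u (onEdge e s)‖ ^ 2 ≤ s * ∑ f ∈ S, (edgeEnergy u' f).toReal := by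
  have step : ∀ e : Γ.Edge, ∀ s ∈ Γ.edgeInterval e,
      ‖u (onEdge e s) - u (start e)‖ ^ 2 ≤ (s - Γ.level e.1) * (edgeEnergy u' e).toReal := by
    intro e s hs
    have hm : AEStronglyMeasurable (fun r => u' (onEdge e r))
        (volume.restrict (Ioc (Γ.level e.1) s)) :=
      (memLp_onEdge hu.memLp_deriv e).1.mono_measure
        (Measure.restrict_mono_set _ (Ioc_subset_Ioc_right hs.2))
    have h1 := enorm_integral_sq_le hs.1.le hm
    rw [← hu.sub_start_eq_integral hs] at h1
    have h2 : ‖u (onEdge e s) - u (start e)‖ₑ ^ 2 ≤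
        ENNReal.ofReal (s - Γ.level e.1) * edgeEnergy u' e :=
      h1.trans (by gcongr; exact lintegral_mono_set (Ioc_subset_Ioc_right hs.2))
    have h3 := ENNReal.toReal_mono
      (ENNReal.mul_ne_top ENNReal.ofReal_ne_top (edgeEnergy_ne_top hu.memLp_deriv e)) h2
    rw [ENNReal.toReal_mul, ENNReal.toReal_ofReal (sub_nonneg.2 hs.1.le), ENNReal.toReal_pow,
      toReal_enorm] at h3
    exact h3
  induction n with
  | zero =>
    rintro ⟨n, q⟩ he s hs
    simp only at he
    subst he
    refine ⟨{⟨0, q⟩}, by simp, ?_⟩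
    have h := step _ s hs
    change ‖_ - u Γ.root‖ ^ 2 ≤ (s - Γ.level 0) * _ at h
    rw [hu.root_eq_zero, sub_zero, Γ.level_zero, sub_zero] at h
    rwa [Finset.sum_singleton]
  | succ n ih =>
    rintro ⟨m, q⟩ he s hs
    simp only at he
    subst he
    obtain ⟨S, hS, hle⟩ := ih ⟨n, fun i => q i.castSucc⟩ rfl (Γ.level (n + 1)) (level_succ_mem _)
    have hnot : (⟨n + 1, q⟩ : Γ.Edge) ∉ S := fun h => absurd (hS _ h) (by simp)
    classical
    refine ⟨insert ⟨n + 1, q⟩ S, ?_, ?_⟩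
    · intro f hf
      rcases Finset.mem_insert.1 hf with rfl | hf
      · exact le_rfl
      · exact (hS f hf).trans (Nat.le_succ n)
    · have h := step _ s hs
      change ‖u (onEdge _ s) - u (onEdge _ (Γ.level (n + 1)))‖ ^ 2 ≤
        (s - Γ.level (n + 1)) * _ at h
      have h1 := sq_add_le_of_sq_le (level_nonneg (n + 1)) (sub_nonneg.2 hs.1.le)
        (Finset.sum_nonneg fun _ _ => ENNReal.toReal_nonneg) ENNReal.toReal_nonneg hle h
      rw [Finset.sum_insert hnot, add_comm (edgeEnergy u' _).toReal]
      rw [add_sub_cancel] at h1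
      refine le_trans ?_ h1
      gcongr
      refine (le_of_eq ?_).trans (norm_add_le _ _)
      rw [add_sub_cancel]

/-- The pointwise estimate `|u(x)|² ≤ |x| ∫ |u'|²`. -/
theorem MemH10.enorm_sq_le {u u' : Γ.Point → ℂ} (hu : MemH10 u u') (x : Γ.Point) :
    ‖u x‖ₑ ^ 2 ≤ ENNReal.ofReal x.height * ∫⁻ y, ‖u' y‖ₑ ^ 2 := by
  rcases x.mem with hx | hx
  · have hxe : x = onEdge x.edge x.height := by rw [onEdge_of_mem hx]
    obtain ⟨S, -, hS⟩ := hu.exists_edges _ x.edge rfl x.height hx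
    rw [← hxe] at hS
    have h1 : ENNReal.ofReal (‖u x‖ ^ 2) ≤ ENNReal.ofReal x.height *
        ∑ f ∈ S, edgeEnergy u' f := by
      refine (ENNReal.ofReal_le_ofReal hS).trans ?_
      rw [ENNReal.ofReal_mul x.height_nonneg,
        ENNReal.ofReal_sum_of_nonneg fun _ _ => ENNReal.toReal_nonneg]
      gcongr with f
      exact ENNReal.ofReal_toReal_le
    rw [ENNReal.ofReal_pow (norm_nonneg _), ofReal_norm] at h1
    refine h1.trans ?_
    gcongr
    rw [lintegral_sq_eq_tsum hu.memLp_deriv]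
    exact ENNReal.sum_le_tsum S
  · have hxr : x = Γ.root := by
      refine (Point.eq_of_le_of_height_eq (Point.root_le x) ?_).symm
      rw [hx.2]; rfl
    rw [hxr, hu.root_eq_zero]
    simp

theorem MemH10.sub {u u' v v' : Γ.Point → ℂ} (hu : MemH10 u u') (hv : MemH10 v v') :
    MemH10 (u - v) (u' - v') := by
  have h := hu.add (hv.smul (-1))
  simpa [sub_eq_add_neg] using h

end RegularTree
end

/-! ### The Hilbert space `H^{1,0}(Γ)` and its dense embedding in `L₂(Γ)` -/

noncomputable section

namespace RegularTree

variable {Γ : RegularTree}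

theorem lintegral_enorm_sq_eq {w : L2 Γ} {u : Γ.Point → ℂ} (h : w =ᵐ[volume] u) :
    ∫⁻ x, ‖u x‖ₑ ^ 2 = ‖w‖ₑ ^ 2 := by
  have h1 : ‖w‖ₑ = eLpNorm u 2 volume := by rw [Lp.enorm_def, eLpNorm_congr_ae h]
  rw [h1, eLpNorm_eq_lintegral_rpow_enorm_toReal two_ne_zero ENNReal.ofNat_ne_top,
    ← ENNReal.rpow_natCast, ← ENNReal.rpow_mul]
  norm_num

theorem norm_le_of_enorm_sq_le {F G : Type*} [SeminormedAddCommGroup F] [SeminormedAddCommGroup G]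
    {y : F} {w : G} {t : ℝ} (ht : 0 ≤ t) (h : ‖y‖ₑ ^ 2 ≤ ENNReal.ofReal t * ‖w‖ₑ ^ 2) :
    ‖y‖ ≤ √t * ‖w‖ := by
  have h1 : ‖y‖ ^ 2 ≤ t * ‖w‖ ^ 2 := by
    rw [← ofReal_norm, ← ofReal_norm, ← ENNReal.ofReal_pow (norm_nonneg _),
      ← ENNReal.ofReal_pow (norm_nonneg _), ← ENNReal.ofReal_mul ht] at h
    exact (ENNReal.ofReal_le_ofReal_iff (by positivity)).1 h
  have h2 : ‖y‖ ^ 2 ≤ (√t * ‖w‖) ^ 2 := by rwa [mul_pow, Real.sq_sqrt ht]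
  exact (pow_le_pow_iff_left₀ (norm_nonneg _) (by positivity) two_ne_zero).1 h2

theorem MemH10.norm_le {u u' : Γ.Point → ℂ} (hu : MemH10 u u') {w : L2 Γ}
    (hw : w =ᵐ[volume] u') (x : Γ.Point) : ‖u x‖ ≤ √x.height * ‖w‖ := by
  refine norm_le_of_enorm_sq_le x.height_nonneg ?_
  rw [← lintegral_enorm_sq_eq hw]
  exact hu.enorm_sq_le x

theorem norm_integral_onEdge_le {g : Γ.Point → ℂ} (hg : MemLp g 2 volume) {w : L2 Γ}
    (hw : w =ᵐ[volume] g) {e : Γ.Edge} {a b : ℝ} (ha : a ∈ Γ.edgeInterval e)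
    (hb : b ∈ Γ.edgeInterval e) (hab : a ≤ b) :
    ‖∫ s in a..b, g (onEdge e s)‖ ≤ √(b - a) * ‖w‖ := by
  refine norm_le_of_enorm_sq_le (sub_nonneg.2 hab) ?_
  have hsub : Ioc a b ⊆ Γ.edgeInterval e := Ioc_subset_Ioc ha.1.le hb.2
  refine (enorm_integral_sq_le hab ((memLp_onEdge hg e).1.mono_measure
    (Measure.restrict_mono_set _ hsub))).trans ?_
  rw [← lintegral_enorm_sq_eq hw, lintegral_sq_eq_tsum hg]
  gcongr
  exact (lintegral_mono_set hsub).trans (ENNReal.le_tsum (f := edgeEnergy g) e)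

variable (Γ) in
/-- The space `H^{1,0}(Γ)`, as the set of all pairs `(u, u')` in `L₂ × L₂`. -/
def h10 : Submodule ℂ (WithLp 2 (L2 Γ × L2 Γ)) where
  carrier := {z | ∃ u u' : Γ.Point → ℂ, MemH10 u u' ∧ z.fst =ᵐ[volume] u ∧ z.snd =ᵐ[volume] u'}
  zero_mem' := ⟨0, 0, MemH10.zero, Lp.coeFn_zero _ _ _, Lp.coeFn_zero _ _ _⟩
  add_mem' := by
    rintro y z ⟨u, u', hu, h1, h2⟩ ⟨v, v', hv, h3, h4⟩
    exact ⟨u + v, u' + v', hu.add hv, (Lp.coeFn_add _ _).trans (h1.add h3),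
      (Lp.coeFn_add _ _).trans (h2.add h4)⟩
  smul_mem' := by
    rintro c z ⟨u, u', hu, h1, h2⟩
    exact ⟨c • u, c • u', hu.smul c, (Lp.coeFn_smul _ _).trans (h1.const_smul c),
      (Lp.coeFn_smul _ _).trans (h2.const_smul c)⟩

/-- A sequence in `H^{1,0}(Γ)` that converges in `L₂` together with the derivatives has its limit
in `H^{1,0}(Γ)`. -/
theorem exists_memH10_of_tendsto {u u' : ℕ → Γ.Point → ℂ} (hu : ∀ n, MemH10 (u n) (u' n))
    {z z' : ℕ → L2 Γ} (hz : ∀ n, z n =ᵐ[volume] u n) (hz' : ∀ n, z' n =ᵐ[volume] u' n)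
    {f g : L2 Γ} (hf : Tendsto z atTop (𝓝 f)) (hg : Tendsto z' atTop (𝓝 g)) :
    ∃ w : Γ.Point → ℂ, MemH10 w g ∧ f =ᵐ[volume] w := by
  -- Convergence of the derivatives in `L₂` forces pointwise convergence of `u n` at every point, so
  -- the limit is an actual function rather than a class.
  have hdiff : ∀ n m x, ‖u n x - u m x‖ ≤ √x.height * ‖z' n - z' m‖ := fun n m x =>
    ((hu n).sub (hu m)).norm_le ((Lp.coeFn_sub _ _).trans ((hz' n).sub (hz' m))) x
  have hcau : ∀ x, CauchySeq fun n => u n x := by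
    intro x
    rw [Metric.cauchySeq_iff']
    intro ε hε
    obtain ⟨N, hN⟩ := Metric.cauchySeq_iff'.1 hg.cauchySeq (ε / (√x.height + 1)) (by positivity)
    refine ⟨N, fun n hn => ?_⟩
    rw [dist_eq_norm]
    have h1 := hN n hn
    rw [dist_eq_norm, lt_div_iff₀ (by positivity)] at h1
    nlinarith [hdiff n N x, norm_nonneg (z' n - z' N), Real.sqrt_nonneg x.height]
  choose w hw using fun x => cauchySeq_tendsto_of_complete (hcau x)
  have hlim : ∀ n x, ‖u n x - w x‖ ≤ √x.height * ‖z' n - g‖ := fun n x =>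
    le_of_tendsto_of_tendsto' (tendsto_const_nhds.sub (hw x)).norm
      ((tendsto_const_nhds.sub hg).norm.const_mul _) fun m => hdiff n m x
  have hg0 : Tendsto (fun n => ‖z' n - g‖) atTop (𝓝 0) := tendsto_iff_norm_sub_tendsto_zero.1 hg
  have hcont : Continuous w := by
    -- The bound grows like `√|x|`, so convergence is uniform only where the height is bounded.
    have hloc : TendstoLocallyUniformly u w atTop := by
      rw [Metric.tendstoLocallyUniformly_iff]
      intro ε hε x
      refine ⟨{y | y.height < x.height + 1}, ?_, ?_⟩
      · exact (continuous_height.tendsto x).eventually (gt_mem_nhds (lt_add_one _))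
      · have h0 : Tendsto (fun n => √(x.height + 1) * ‖z' n - g‖) atTop (𝓝 0) := by
          have := hg0.const_mul (√(x.height + 1))
          rwa [mul_zero] at this
        filter_upwards [h0.eventually (gt_mem_nhds hε)] with n hn y hy
        rw [dist_comm, dist_eq_norm]
        refine lt_of_le_of_lt ((hlim n y).trans ?_) hn
        gcongr
    exact hloc.continuous (Frequently.of_forall fun n => (hu n).continuous)
  have hfw : f =ᵐ[volume] w := by
    obtain ⟨ns, hns, hae⟩ := (tendstoInMeasure_of_tendsto_Lp hf).exists_seq_tendsto_ae
    filter_upwards [hae, ae_all_iff.2 hz] with x hx hzx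
    refine tendsto_nhds_unique hx ?_
    have he : (fun i => z (ns i) x) = fun i => u (ns i) x := funext fun i => hzx (ns i)
    rw [he]
    exact (hw x).comp hns.tendsto_atTop
  have key : ∀ e : Γ.Edge, ∀ a ∈ Γ.edgeInterval e, ∀ b ∈ Γ.edgeInterval e, a ≤ b →
      w (onEdge e b) - w (onEdge e a) = ∫ s in a..b, g (onEdge e s) := by
    intro e a ha b hb hab
    refine tendsto_nhds_unique ((hw (onEdge e b)).sub (hw (onEdge e a))) ?_
    rw [tendsto_iff_norm_sub_tendsto_zero]
    refine squeeze_zero (fun _ => norm_nonneg _) (fun n => ?_)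
      (by simpa using hg0.const_mul (√(b - a)))
    rw [(hu n).sub_eq_integral e a ha b hb, ← intervalIntegral.integral_sub
      (intervalIntegrable_onEdge (hu n).memLp_deriv e ha hb)
      (intervalIntegrable_onEdge (Lp.memLp g) e ha hb)]
    exact norm_integral_onEdge_le (g := u' n - (g : Γ.Point → ℂ)) ((hu n).memLp_deriv.sub (Lp.memLp g))
      ((Lp.coeFn_sub _ _).trans ((hz' n).sub (ae_eq_refl _))) ha hb hab
  refine ⟨w, ⟨⟨hcont, (memLp_congr_ae hfw).1 (Lp.memLp f), Lp.memLp g, fun e a ha b hb => ?_⟩,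
    ?_⟩, hfw⟩
  · rcases le_total a b with hab | hab
    · exact key e a ha b hb hab
    · rw [intervalIntegral.integral_symm, ← key e b hb a ha hab, neg_sub]
  · refine tendsto_nhds_unique (hw Γ.root) ?_
    simp only [(hu _).root_eq_zero]
    exact tendsto_const_nhds

theorem isClosed_h10 : IsClosed (h10 Γ : Set (WithLp 2 (L2 Γ × L2 Γ))) := by
  refine IsSeqClosed.isClosed fun z y hz hy => ?_
  choose u u' hu h1 h2 using hz
  obtain ⟨w, hw, hfw⟩ := exists_memH10_of_tendsto hu h1 h2
    (((WithLp.fstL 2 ℂ (L2 Γ) (L2 Γ)).continuous.tendsto y).comp hy)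
    (((WithLp.sndL 2 ℂ (L2 Γ) (L2 Γ)).continuous.tendsto y).comp hy)
  exact ⟨w, _, hw, hfw, ae_eq_refl _⟩

instance : CompleteSpace (h10 Γ) := isClosed_h10.completeSpace_coe

variable (Γ) in
/-- The embedding of `H^{1,0}(Γ)` into `L₂(Γ)`. -/
def h10Embed : h10 Γ →L[ℂ] L2 Γ := (WithLp.fstL 2 ℂ (L2 Γ) (L2 Γ)).comp (h10 Γ).subtypeL

variable (Γ) in
/-- The derivative, as a map from `H^{1,0}(Γ)` to `L₂(Γ)`. -/
def h10Deriv : h10 Γ →L[ℂ] L2 Γ := (WithLp.sndL 2 ℂ (L2 Γ) (L2 Γ)).comp (h10 Γ).subtypeL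

theorem norm_sq_h10 (z : h10 Γ) : ‖z‖ ^ 2 = ‖h10Embed Γ z‖ ^ 2 + ‖h10Deriv Γ z‖ ^ 2 :=
  WithLp.prod_norm_sq_eq_of_L2 (z : WithLp 2 (L2 Γ × L2 Γ))

theorem exists_memH10 (z : h10 Γ) : ∃ u u' : Γ.Point → ℂ, MemH10 u u' ∧
    h10Embed Γ z =ᵐ[volume] u ∧ h10Deriv Γ z =ᵐ[volume] u' := z.2

/-- The element of `H^{1,0}(Γ)` given by a function. -/
def MemH10.toH10 {u u' : Γ.Point → ℂ} (hu : MemH10 u u') : h10 Γ :=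
  ⟨WithLp.toLp 2 (hu.memLp.toLp u, hu.memLp_deriv.toLp u'),
    u, u', hu, hu.memLp.coeFn_toLp, hu.memLp_deriv.coeFn_toLp⟩

theorem MemH10.embed_toH10 {u u' : Γ.Point → ℂ} (hu : MemH10 u u') :
    h10Embed Γ hu.toH10 =ᵐ[volume] u := hu.memLp.coeFn_toLp

theorem MemH10.deriv_toH10 {u u' : Γ.Point → ℂ} (hu : MemH10 u u') :
    h10Deriv Γ hu.toH10 =ᵐ[volume] u' := hu.memLp_deriv.coeFn_toLp

/-- The derivative of a function in `H^{1,0}(Γ)` is determined by the function. -/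
theorem MemH10.deriv_eq_zero {u u' : Γ.Point → ℂ} (hu : MemH10 u u') (h0 : u =ᵐ[volume] 0) :
    u' =ᵐ[volume] 0 := by
  have hzero : ∫⁻ x, ‖u x‖ₑ ^ 2 = 0 := by
    rw [lintegral_congr_ae (g := fun _ => 0) (by filter_upwards [h0] with x hx; simp [hx])]
    simp
  rw [lintegral_sq_eq_tsum hu.memLp, ENNReal.tsum_eq_zero] at hzero
  suffices h : ∫⁻ x, ‖u' x‖ₑ ^ 2 = 0 by
    rw [lintegral_eq_zero_iff' (hu.memLp_deriv.1.enorm.pow_const 2)] at h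
    filter_upwards [h] with x hx
    simpa using hx
  rw [lintegral_sq_eq_tsum hu.memLp_deriv, ENNReal.tsum_eq_zero]
  intro e
  have h1 : (fun s => u (onEdge e s)) =ᵐ[volume.restrict (Ioo (Γ.level e.1) (Γ.level (e.1 + 1)))]
      fun _ => 0 := by
    have h2 := hzero e
    unfold edgeEnergy at h2
    rw [lintegral_eq_zero_iff' ((memLp_onEdge hu.memLp e).1.enorm.pow_const 2)] at h2
    have h3 := ae_mono (Measure.restrict_mono_set volume Ioo_subset_Ioc_self) h2
    filter_upwards [h3] with x hx
    simpa using hx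
  -- A continuous function that vanishes almost everywhere on an open interval vanishes identically
  -- there.
  have h2 : EqOn (fun s => u (onEdge e s)) (fun _ => 0)
      (Ioo (Γ.level e.1) (Γ.level (e.1 + 1))) := by
    refine Measure.eqOn_open_of_ae_eq h1 isOpen_Ioo ?_ continuousOn_const
    exact hu.continuous.comp_continuousOn ((continuousOn_onEdge e).mono Ioo_subset_Ioc_self)
  have hint : IntervalIntegrable (fun r => u' (onEdge e r)) volume (Γ.level e.1)
      (Γ.level (e.1 + 1)) := by
    rw [intervalIntegrable_iff_integrableOn_Ioc_of_le (level_lt_succ _).le]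
    exact (memLp_onEdge hu.memLp_deriv e).integrable one_le_two
  unfold edgeEnergy edgeInterval
  rw [setLIntegral_congr Ioo_ae_eq_Ioc.symm, lintegral_eq_zero_iff' (((memLp_onEdge
    hu.memLp_deriv e).1.mono_measure (Measure.restrict_mono_set volume
      Ioo_subset_Ioc_self)).enorm.pow_const 2), Filter.EventuallyEq,
    ae_restrict_iff' measurableSet_Ioo]
  filter_upwards [hint.ae_hasDerivAt_integral] with x hx hxm
  have hd := hx (by rw [uIcc_of_le (level_lt_succ _).le]; exact Ioo_subset_Icc_self hxm)
    (Γ.level e.1) left_mem_uIcc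
  -- The primitive of `u'` is constant on the open edge, while by Lebesgue differentiation its
  -- derivative is `u'` almost everywhere.
  have hc : HasDerivAt (fun t => ∫ r in (Γ.level e.1)..t, u' (onEdge e r)) 0 x := by
    refine (hasDerivAt_const x (-u (start e))).congr_of_eventuallyEq ?_
    filter_upwards [isOpen_Ioo.mem_nhds hxm] with t ht
    rw [← hu.sub_start_eq_integral (Ioo_subset_Ioc_self ht)]
    have := h2 ht
    simp only at this
    rw [this, zero_sub]
  rw [hd.unique hc]
  simp

theorem h10Embed_injective : Function.Injective (h10Embed Γ) := by
  rw [injective_iff_map_eq_zero]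
  intro z hz
  obtain ⟨u, u', hu, h1, h2⟩ := exists_memH10 z
  have h3 : u =ᵐ[volume] 0 := by
    rw [hz] at h1
    exact h1.symm.trans (Lp.coeFn_zero _ _ _)
  have h4 : h10Deriv Γ z = 0 := by
    rw [Lp.eq_zero_iff_ae_eq_zero]
    exact h2.trans (hu.deriv_eq_zero h3)
  have h5 := norm_sq_h10 z
  rw [hz, h4, norm_zero] at h5
  exact norm_eq_zero.1 (by simpa using h5)

/-- Off an edge, the distance to a point of the edge is at least the distance to its ends. -/
theorem level_sub_le_dist {x y : Γ.Point} (h : y.edge ≠ x.edge) :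
    x.height - Γ.level x.edge.1 ≤ dist x y ∨ Γ.level (x.edge.1 + 1) - x.height ≤ dist x y := by
  -- Either the path to `y` uses the edge of `x`, and then `y` lies beyond its upper end, or the
  -- paths to `x` and `y` part no higher than its lower end.
  by_cases hQ : ∃ hg : x.edge.1 ≤ y.edge.1,
      ∀ i : Fin (x.edge.1 + 1), x.edge.2 i = y.edge.2 (Fin.castLE (Nat.succ_le_succ hg) i)
  · right
    obtain ⟨hg, hi⟩ := hQ
    rcases hg.lt_or_eq with hlt | heq
    · have h1 : Γ.level (x.edge.1 + 1) ≤ Γ.level y.edge.1 := Γ.level_strictMono.monotone hlt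
      have h2 := y.level_le
      have h3 := abs_height_sub_le x y
      rw [abs_le] at h3
      linarith
    · exfalso
      apply h
      obtain ⟨⟨n, p⟩, s, hs⟩ := x
      obtain ⟨⟨m, q⟩, r, hr⟩ := y
      simp only at heq
      subst heq
      have hpq : p = q := funext fun i => hi i
      rw [hpq]
  · left
    have hm : meetHeight x y ≤ Γ.level x.edge.1 := by
      refine csSup_le (Point.nonempty_common x y) ?_
      rintro _ ⟨z, hz, rfl⟩
      by_contra! hlt
      apply hQ
      have hg : x.edge.1 ≤ z.edge.1 :=
        Nat.lt_succ_iff.1 (Γ.level_strictMono.lt_iff_lt.1 (hlt.trans_le z.le_level))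
      refine ⟨hg.trans hz.2.2.1, fun i => ?_⟩
      have e1 := hz.1.2.2 (Fin.castLE (Nat.succ_le_succ hg) i)
      have e2 := hz.2.2.2 (Fin.castLE (Nat.succ_le_succ hg) i)
      exact e1.symm.trans e2
    have h2 := Point.meetHeight_le y x
    rw [Point.meetHeight_comm] at h2
    rw [dist_eq]
    linarith

/-- The extension by zero of a function on an edge. -/
def extendEdge (e : Γ.Edge) (φ : ℝ → ℂ) : Γ.Point → ℂ :=
  open Classical in fun x => if x.edge = e then φ x.height else 0

theorem extendEdge_onEdge_self {e : Γ.Edge} (φ : ℝ → ℂ) {s : ℝ} (hs : s ∈ Γ.edgeInterval e) :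
    extendEdge e φ (onEdge e s) = φ s := by
  unfold extendEdge
  rw [if_pos (edge_onEdge e s), height_onEdge hs]

theorem extendEdge_onEdge_of_ne {e f : Γ.Edge} (φ : ℝ → ℂ) (hf : f ≠ e) (s : ℝ) :
    extendEdge e φ (onEdge f s) = 0 := by
  unfold extendEdge
  rw [if_neg (by rwa [edge_onEdge])]

/-- A path from a point of the edge to a point off it covers at least the distance to one of the
ends, where `φ` vanishes. -/
theorem extendEdge_norm_le {e : Γ.Edge} {φ : ℝ → ℂ} {L : ℝ≥0} (hφ : LipschitzWith L φ)
    (h0 : φ (Γ.level e.1) = 0) (h1 : φ (Γ.level (e.1 + 1)) = 0) {x y : Γ.Point}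
    (hy : y.edge ≠ e) : ‖extendEdge e φ x‖ ≤ L * dist x y := by
  unfold extendEdge
  split_ifs with hx
  · subst hx
    rcases level_sub_le_dist hy with h | h
    · have := hφ.dist_le_mul x.height (Γ.level x.edge.1)
      rw [h0, dist_zero_right, Real.dist_eq, abs_of_nonneg (sub_nonneg.2 x.level_le)] at this
      exact this.trans (by gcongr)
    · have := hφ.dist_le_mul x.height (Γ.level (x.edge.1 + 1))
      rw [h1, dist_zero_right, Real.dist_eq, abs_sub_comm,
        abs_of_nonneg (sub_nonneg.2 x.le_level)] at this
      exact this.trans (by gcongr)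
  · rw [norm_zero]; positivity

theorem continuous_extendEdge {e : Γ.Edge} {φ : ℝ → ℂ} {L : ℝ≥0} (hφ : LipschitzWith L φ)
    (h0 : φ (Γ.level e.1) = 0) (h1 : φ (Γ.level (e.1 + 1)) = 0) :
    Continuous (extendEdge e φ) := by
  refine (LipschitzWith.of_dist_le_mul (K := L) fun x y => ?_).continuous
  by_cases hy : y.edge = e
  · by_cases hx : x.edge = e
    · unfold extendEdge
      rw [if_pos hx, if_pos hy]
      refine (hφ.dist_le_mul _ _).trans ?_
      gcongr
      exact abs_height_sub_le x y
    · have h := extendEdge_norm_le hφ h0 h1 (x := y) hx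
      have h2 : extendEdge e φ x = 0 := if_neg hx
      rwa [h2, dist_zero_left, dist_comm]
  · have h := extendEdge_norm_le hφ h0 h1 (x := x) hy
    have h2 : extendEdge e φ y = 0 := if_neg hy
    rwa [h2, dist_zero_right]

theorem memLp_extendEdge {e : Γ.Edge} {φ : ℝ → ℂ} {L : ℝ≥0} (hφ : LipschitzWith L φ)
    (h0 : φ (Γ.level e.1) = 0) (h1 : φ (Γ.level (e.1 + 1)) = 0) :
    MemLp (extendEdge e φ) 2 volume := by
  have hm := (continuous_extendEdge hφ h0 h1).aestronglyMeasurable (μ := (volume : Measure Γ.Point))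
  refine ⟨hm, ?_⟩
  rw [eLpNorm_lt_top_iff_lintegral_rpow_enorm_lt_top two_ne_zero ENNReal.ofNat_ne_top,
    lintegral_eq_tsum (hm.enorm.pow_const _), tsum_eq_single e]
  · rw [setLIntegral_congr_fun measurableSet_Ioc (g := fun s => ‖φ s‖ₑ ^ (2 : ℝ≥0∞).toReal)
      fun s hs => by simp only; rw [extendEdge_onEdge_self φ hs]]
    have hφ2 : MemLp φ 2 (volume.restrict (Γ.edgeInterval e)) := by
      obtain ⟨B, hB⟩ := isCompact_Icc.exists_bound_of_continuousOn (s := Icc (Γ.level e.1)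
        (Γ.level (e.1 + 1))) hφ.continuous.continuousOn
      refine MemLp.of_bound hφ.continuous.aestronglyMeasurable B ?_
      filter_upwards [ae_restrict_mem measurableSet_Ioc] with s hs
      exact hB s (Ioc_subset_Icc_self hs)
    exact (eLpNorm_lt_top_iff_lintegral_rpow_enorm_lt_top two_ne_zero
      ENNReal.ofNat_ne_top).1 hφ2.2
  · intro f hf
    simp [extendEdge_onEdge_of_ne φ hf]

/-- Smooth functions compactly supported inside one open edge supply the test functions for the
density of the form domain. -/
theorem memH10_extendEdge {e : Γ.Edge} {g : ℝ → ℝ} (hg : ContDiff ℝ ((⊤ : ℕ∞) : WithTop ℕ∞) g)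
    (hc : HasCompactSupport g)
    (hsupp : tsupport g ⊆ Ioo (Γ.level e.1) (Γ.level (e.1 + 1))) :
    MemH10 (extendEdge e fun s => (g s : ℂ)) (extendEdge e fun s => ((deriv g s : ℝ) : ℂ)) := by
  have hlip : ∀ {f : ℝ → ℝ}, ContDiff ℝ ((⊤ : ℕ∞) : WithTop ℕ∞) f → HasCompactSupport f →
      ∃ L : ℝ≥0, LipschitzWith L fun s => (f s : ℂ) := by
    intro f hf hfc
    obtain ⟨L, hL⟩ := hf.lipschitzWith_of_hasCompactSupport hfc (by simp)
    exact ⟨1 * L, Complex.isometry_ofReal.lipschitz.comp hL⟩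
  have hz : ∀ {f : ℝ → ℝ}, tsupport f ⊆ Ioo (Γ.level e.1) (Γ.level (e.1 + 1)) →
      ∀ s, s ∉ Ioo (Γ.level e.1) (Γ.level (e.1 + 1)) → (f s : ℂ) = 0 := by
    intro f hf s hs
    rw [image_eq_zero_of_notMem_tsupport fun h => hs (hf h), Complex.ofReal_zero]
  have hg' : ContDiff ℝ ((⊤ : ℕ∞) : WithTop ℕ∞) (deriv g) := (contDiff_infty_iff_deriv.1 hg).2
  obtain ⟨L, hL⟩ := hlip hg hc
  obtain ⟨L', hL'⟩ := hlip hg' hc.deriv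
  have hsupp' : tsupport (deriv g) ⊆ Ioo (Γ.level e.1) (Γ.level (e.1 + 1)) :=
    tsupport_deriv_subset.trans hsupp
  refine ⟨⟨continuous_extendEdge hL (hz hsupp _ (by simp)) (hz hsupp _ (by simp)),
    memLp_extendEdge hL (hz hsupp _ (by simp)) (hz hsupp _ (by simp)),
    memLp_extendEdge hL' (hz hsupp' _ (by simp)) (hz hsupp' _ (by simp)), fun f a ha b hb => ?_⟩, ?_⟩
  · by_cases hf : f = e
    · subst hf
      rw [extendEdge_onEdge_self _ ha, extendEdge_onEdge_self _ hb]
      have hsub : uIcc a b ⊆ Γ.edgeInterval f := ordConnected_Ioc.uIcc_subset ha hb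
      have he : EqOn (fun s => extendEdge f (fun r => ((deriv g r : ℝ) : ℂ)) (onEdge f s))
          (fun s => ((deriv g s : ℝ) : ℂ)) (uIcc a b) :=
        fun s hs => extendEdge_onEdge_self _ (hsub hs)
      rw [intervalIntegral.integral_congr he, intervalIntegral.integral_ofReal,
        intervalIntegral.integral_deriv_eq_sub
          (fun s _ => hg.differentiable (by simp) s)
          (hg'.continuous.intervalIntegrable _ _)]
      push_cast
      rfl
    · simp only [extendEdge_onEdge_of_ne _ hf, sub_self, intervalIntegral.integral_zero]
  · unfold extendEdge
    split_ifs with h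
    · refine hz hsupp _ fun hmem => ?_
      exact absurd hmem.1 (not_lt.2 (level_nonneg _))
    · rfl

/-- A function orthogonal to the range is orthogonal to all smooth bumps on each open edge, and so
vanishes by the fundamental lemma of the calculus of variations. -/
theorem denseRange_h10Embed : DenseRange (h10Embed Γ) := by
  have h : (LinearMap.range (h10Embed Γ : h10 Γ →ₗ[ℂ] L2 Γ)).topologicalClosure = ⊤ := by
    rw [Submodule.topologicalClosure_eq_top_iff, Submodule.eq_bot_iff]
    intro f hf
    rw [Lp.eq_zero_iff_ae_eq_zero]
    suffices h : ∫⁻ x, ‖f x‖ₑ ^ 2 = 0 by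
      rw [lintegral_eq_zero_iff' ((Lp.memLp f).1.enorm.pow_const 2)] at h
      filter_upwards [h] with x hx
      simpa using hx
    rw [lintegral_sq_eq_tsum (Lp.memLp f), ENNReal.tsum_eq_zero]
    intro e
    have hint : IntegrableOn (fun s => f (onEdge e s)) (Γ.edgeInterval e) :=
      (memLp_onEdge (Lp.memLp f) e).integrable one_le_two
    have hae := isOpen_Ioo.ae_eq_zero_of_integral_contDiff_smul_eq_zero
      (hint.mono_set Ioo_subset_Ioc_self).locallyIntegrableOn
      (f := fun s => f (onEdge e s)) (U := Ioo (Γ.level e.1) (Γ.level (e.1 + 1))) (μ := volume)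
      (fun g hg hc hsupp => ?_)
    · unfold edgeEnergy edgeInterval
      rw [setLIntegral_congr Ioo_ae_eq_Ioc.symm, lintegral_eq_zero_iff' (((memLp_onEdge
        (Lp.memLp f) e).1.mono_measure (Measure.restrict_mono_set volume
          Ioo_subset_Ioc_self)).enorm.pow_const 2), Filter.EventuallyEq,
        ae_restrict_iff' measurableSet_Ioo]
      filter_upwards [hae] with x hx hxm
      rw [hx hxm]
      simp
    · have hm := memH10_extendEdge hg hc hsupp
      have h0 := (Submodule.mem_orthogonal _ _).1 hf _ ⟨hm.toH10, rfl⟩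
      have hfun : (fun x => inner ℂ ((h10Embed Γ hm.toH10) x) (f x)) =ᵐ[volume]
          fun x => extendEdge e (fun s => (g s : ℂ)) x * f x := by
        filter_upwards [hm.embed_toH10] with x hx
        rw [hx]
        unfold extendEdge
        split_ifs
        · simp [mul_comm]
        · simp
      have hI : Integrable (fun x => extendEdge e (fun s => (g s : ℂ)) x * f x) volume :=
        hm.memLp.integrable_mul (Lp.memLp f)
      have hs := hasSum_integral_measure (μ := fun e : Γ.Edge =>
        ((volume : Measure ℝ).restrict (Γ.edgeInterval e)).map (onEdge e)) hI
      have hterm : ∀ e' : Γ.Edge, ∫ x, extendEdge e (fun s => (g s : ℂ)) x * f x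
          ∂(((volume : Measure ℝ).restrict (Γ.edgeInterval e')).map (onEdge e')) =
          ∫ s in Γ.edgeInterval e', extendEdge e (fun s => (g s : ℂ)) (onEdge e' s) *
            f (onEdge e' s) := fun e' =>
        integral_map (aemeasurable_onEdge e') (hI.1.mono_measure (map_onEdge_le e'))
      have h1 := hs.unique (hasSum_single e fun e' he' => by
        rw [hterm]
        simp only [extendEdge_onEdge_of_ne _ he', zero_mul, integral_zero])
      rw [hterm] at h1
      have h2 : ∫ x, extendEdge e (fun s => (g s : ℂ)) x * f x = 0 := by
        rw [← integral_congr_ae hfun, ← L2.inner_def]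
        exact h0
      have h3 : ∫ s in Γ.edgeInterval e, extendEdge e (fun s => (g s : ℂ)) (onEdge e s) *
            f (onEdge e s) = 0 := h1.symm.trans h2
      rw [← setIntegral_eq_integral_of_forall_compl_eq_zero (s := Γ.edgeInterval e)
        fun s hs => ?_, ← h3]
      · refine setIntegral_congr_fun measurableSet_Ioc fun s hs => ?_
        rw [extendEdge_onEdge_self _ hs, Complex.real_smul]
      · rw [image_eq_zero_of_notMem_tsupport fun h => hs (Ioo_subset_Ioc_self (hsupp h)), zero_smul]
  rw [← Submodule.dense_iff_topologicalClosure_eq_top] at h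
  exact h

end RegularTree
end

/-! ### Form-bounded potentials and the Schrödinger operator -/

noncomputable section

namespace RegularTree

variable {Γ : RegularTree}

/-- `∫ W |u|² ≤ ¾ ∫ |u'|² + k ∫ |u|²` on `H^{1,0}(Γ)`. -/
structure IsFormBounded (W : Γ.Point → ℝ) (k : ℝ) : Prop where
  aemeasurable : AEMeasurable W volume
  nonneg : ∀ x, 0 ≤ W x
  const_nonneg : 0 ≤ k
  bound : ∀ u u' : Γ.Point → ℂ, MemH10 u u' →
    ∫⁻ x, ENNReal.ofReal (W x) * ‖u x‖ₑ ^ 2 ≤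
      ENNReal.ofReal (3 / 4) * (∫⁻ x, ‖u' x‖ₑ ^ 2) + ENNReal.ofReal k * ∫⁻ x, ‖u x‖ₑ ^ 2

theorem enorm_sqrt_mul_sq {W : ℝ} (hW : 0 ≤ W) (z : ℂ) :
    ‖(√W : ℂ) * z‖ₑ ^ 2 = ENNReal.ofReal W * ‖z‖ₑ ^ 2 := by
  rw [enorm_mul, mul_pow]
  congr 1
  rw [← ofReal_norm, ← ENNReal.ofReal_pow (norm_nonneg _), Complex.norm_real, Real.norm_eq_abs,
    sq_abs, Real.sq_sqrt hW]

namespace IsFormBounded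

variable {W : Γ.Point → ℝ} {k : ℝ}

theorem memLp (hW : IsFormBounded W k) {u u' : Γ.Point → ℂ} (hu : MemH10 u u') :
    MemLp (fun x => (√(W x) : ℂ) * u x) 2 volume := by
  refine ⟨?_, ?_⟩
  · exact (Complex.continuous_ofReal.measurable.comp_aemeasurable
      hW.aemeasurable.sqrt).aestronglyMeasurable.mul hu.memLp.1
  · rw [eLpNorm_lt_top_iff_lintegral_rpow_enorm_lt_top two_ne_zero ENNReal.ofNat_ne_top]
    simp only [ENNReal.toReal_ofNat, ENNReal.rpow_ofNat, enorm_sqrt_mul_sq (hW.nonneg _)]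
    refine (hW.bound u u' hu).trans_lt (ENNReal.add_lt_top.2 ⟨?_, ?_⟩)
    · exact ENNReal.mul_lt_top ENNReal.ofReal_lt_top (lintegral_sq_lt_top hu.memLp_deriv)
    · exact ENNReal.mul_lt_top ENNReal.ofReal_lt_top (lintegral_sq_lt_top hu.memLp)

theorem memLp_embed (hW : IsFormBounded W k) (z : h10 Γ) :
    MemLp (fun x => (√(W x) : ℂ) * h10Embed Γ z x) 2 volume := by
  obtain ⟨u, u', hu, h1, -⟩ := exists_memH10 z
  refine (memLp_congr_ae ?_).2 (hW.memLp hu)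
  filter_upwards [h1] with x hx
  rw [hx]

/-- Multiplication by `√W`, as a linear map from `H^{1,0}(Γ)` to `L₂(Γ)`. -/
def mulSqrtₗ (hW : IsFormBounded W k) : h10 Γ →ₗ[ℂ] L2 Γ where
  toFun z := (hW.memLp_embed z).toLp _
  map_add' y z := by
    refine Lp.ext ?_
    filter_upwards [(hW.memLp_embed (y + z)).coeFn_toLp, (hW.memLp_embed y).coeFn_toLp,
      (hW.memLp_embed z).coeFn_toLp, Lp.coeFn_add ((hW.memLp_embed y).toLp _)
      ((hW.memLp_embed z).toLp _), Lp.coeFn_add (h10Embed Γ y) (h10Embed Γ z)] with x h1 h2 h3 h4 h5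
    rw [h1, h4, Pi.add_apply, h2, h3, map_add, h5, Pi.add_apply, mul_add]
  map_smul' c z := by
    refine Lp.ext ?_
    filter_upwards [(hW.memLp_embed (c • z)).coeFn_toLp, (hW.memLp_embed z).coeFn_toLp,
      Lp.coeFn_smul c ((hW.memLp_embed z).toLp _), Lp.coeFn_smul c (h10Embed Γ z)] with x h1 h2 h3 h4
    rw [h1, RingHom.id_apply, h3, Pi.smul_apply, h2, map_smul, h4, Pi.smul_apply, smul_eq_mul,
      smul_eq_mul]
    ring

theorem mulSqrtₗ_ae (hW : IsFormBounded W k) {z : h10 Γ} {u : Γ.Point → ℂ}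
    (h : h10Embed Γ z =ᵐ[volume] u) :
    hW.mulSqrtₗ z =ᵐ[volume] fun x => (√(W x) : ℂ) * u x := by
  filter_upwards [(hW.memLp_embed z).coeFn_toLp, h] with x h1 h2
  rw [← h2]
  exact h1

theorem enorm_mulSqrtₗ_sq (hW : IsFormBounded W k) {z : h10 Γ} {u : Γ.Point → ℂ}
    (h : h10Embed Γ z =ᵐ[volume] u) :
    ‖hW.mulSqrtₗ z‖ₑ ^ 2 = ∫⁻ x, ENNReal.ofReal (W x) * ‖u x‖ₑ ^ 2 := by
  rw [← lintegral_enorm_sq_eq (hW.mulSqrtₗ_ae h)]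
  simp only [enorm_sqrt_mul_sq (hW.nonneg _)]

theorem norm_mulSqrtₗ_sq_le (hW : IsFormBounded W k) (z : h10 Γ) :
    ‖hW.mulSqrtₗ z‖ ^ 2 ≤ 3 / 4 * ‖h10Deriv Γ z‖ ^ 2 + k * ‖h10Embed Γ z‖ ^ 2 := by
  obtain ⟨u, u', hu, h1, h2⟩ := exists_memH10 z
  have h := hW.bound u u' hu
  rw [← hW.enorm_mulSqrtₗ_sq h1, lintegral_enorm_sq_eq h1, lintegral_enorm_sq_eq h2] at h
  have hk := hW.const_nonneg
  simp only [← ofReal_norm] at h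
  rw [← ENNReal.ofReal_pow (norm_nonneg _), ← ENNReal.ofReal_pow (norm_nonneg _),
    ← ENNReal.ofReal_pow (norm_nonneg _), ← ENNReal.ofReal_mul (by norm_num),
    ← ENNReal.ofReal_mul hk, ← ENNReal.ofReal_add (by positivity) (by positivity)] at h
  exact (ENNReal.ofReal_le_ofReal_iff (by positivity)).1 h

/-- Multiplication by `√W`, as a bounded operator from `H^{1,0}(Γ)` to `L₂(Γ)`. -/
def mulSqrt (hW : IsFormBounded W k) : h10 Γ →L[ℂ] L2 Γ :=
  hW.mulSqrtₗ.mkContinuous (1 + k) fun z => by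
    have h := hW.norm_mulSqrtₗ_sq_le z
    have hk := hW.const_nonneg
    refine (pow_le_pow_iff_left₀ (norm_nonneg _) (by positivity) two_ne_zero).1 ?_
    have h2 := norm_sq_h10 z
    nlinarith [sq_nonneg ‖h10Deriv Γ z‖, sq_nonneg ‖h10Embed Γ z‖,
      mul_nonneg hk (sq_nonneg ‖h10Deriv Γ z‖), mul_nonneg hk (sq_nonneg ‖h10Embed Γ z‖),
      mul_nonneg (mul_nonneg hk hk) (sq_nonneg ‖z‖)]

theorem mulSqrt_ae (hW : IsFormBounded W k) {z : h10 Γ} {u : Γ.Point → ℂ}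
    (h : h10Embed Γ z =ᵐ[volume] u) :
    hW.mulSqrt z =ᵐ[volume] fun x => (√(W x) : ℂ) * u x := hW.mulSqrtₗ_ae h

theorem enorm_mulSqrt_sq (hW : IsFormBounded W k) {z : h10 Γ} {u : Γ.Point → ℂ}
    (h : h10Embed Γ z =ᵐ[volume] u) :
    ‖hW.mulSqrt z‖ₑ ^ 2 = ∫⁻ x, ENNReal.ofReal (W x) * ‖u x‖ₑ ^ 2 := hW.enorm_mulSqrtₗ_sq h

/-- The relative bound 3/4 leaves a quarter of the energy; the shift by `k + 1` absorbs `k` and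
keeps a full copy of the `L₂` norm. -/
theorem coercive (hW : IsFormBounded W k) (z : h10 Γ) :
    1 / 4 * ‖z‖ ^ 2 ≤ ‖h10Deriv Γ z‖ ^ 2 - ‖hW.mulSqrt z‖ ^ 2 + (k + 1) * ‖h10Embed Γ z‖ ^ 2 := by
  have h : ‖hW.mulSqrt z‖ ^ 2 ≤ _ := hW.norm_mulSqrtₗ_sq_le z
  rw [norm_sq_h10]
  nlinarith [sq_nonneg ‖h10Embed Γ z‖]

/-- Writing `W = √W · √W` turns the potential term into an inner product of `L₂` functions, which
makes it integrable. -/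
theorem integrable_form_and_eq (hW : IsFormBounded W k) {z y : h10 Γ} {u u' v v' : Γ.Point → ℂ}
    (h1 : h10Embed Γ z =ᵐ[volume] u) (h2 : h10Deriv Γ z =ᵐ[volume] u')
    (h3 : h10Embed Γ y =ᵐ[volume] v) (h4 : h10Deriv Γ y =ᵐ[volume] v') :
    Integrable (fun x => u' x * conj (v' x) - W x * (u x * conj (v x))) volume ∧
      ∫ x, (u' x * conj (v' x) - W x * (u x * conj (v x))) =
        inner ℂ (h10Deriv Γ y) (h10Deriv Γ z) - inner ℂ (hW.mulSqrt y) (hW.mulSqrt z) := by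
  have e : (fun x => u' x * conj (v' x) - W x * (u x * conj (v x))) =ᵐ[volume]
      fun x => inner ℂ (h10Deriv Γ y x) (h10Deriv Γ z x) -
        inner ℂ (hW.mulSqrt y x) (hW.mulSqrt z x) := by
    filter_upwards [h2, h4, hW.mulSqrt_ae h1, hW.mulSqrt_ae h3] with x e1 e2 e3 e4
    rw [e1, e2, e3, e4]
    simp only [RCLike.inner_apply, map_mul, Complex.conj_ofReal]
    have : (W x : ℂ) = (√(W x) : ℂ) * (√(W x) : ℂ) := by
      rw [← Complex.ofReal_mul, Real.mul_self_sqrt (hW.nonneg x)]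
    rw [this]
    ring
  have i1 := L2.integrable_inner (𝕜 := ℂ) (h10Deriv Γ y) (h10Deriv Γ z)
  have i2 := L2.integrable_inner (𝕜 := ℂ) (hW.mulSqrt y) (hW.mulSqrt z)
  refine ⟨(i1.sub i2).congr e.symm, ?_⟩
  rw [integral_congr_ae e, integral_sub i1 i2, L2.inner_def, L2.inner_def]

theorem schrodingerGraph_eq (hW : IsFormBounded W k) :
    (schrodingerGraph W : Set (L2 Γ × L2 Γ)) =
      formGraph (h10Embed Γ) (h10Deriv Γ) hW.mulSqrt := by
  have hinner : ∀ (y : h10 Γ) (v : Γ.Point → ℂ) (g : L2 Γ), h10Embed Γ y =ᵐ[volume] v →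
      ∫ x, g x * conj (v x) = inner ℂ (h10Embed Γ y) g := by
    intro y v g h
    rw [L2.inner_def]
    refine integral_congr_ae ?_
    filter_upwards [h] with x hx
    rw [hx]
    simp
  ext q
  constructor
  · rintro ⟨u, u', hu, hqu, hq⟩
    refine ⟨hu.toH10, Lp.ext (hqu.trans hu.embed_toH10.symm), fun y => ?_⟩
    obtain ⟨v, v', hv, h3, h4⟩ := exists_memH10 y
    rw [← (hW.integrable_form_and_eq hu.embed_toH10 hu.deriv_toH10 h3 h4).2, (hq v v' hv).2,
      hinner y v q.2 h3]
  · rintro ⟨z, hz, hq⟩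
    obtain ⟨u, u', hu, h1, h2⟩ := exists_memH10 z
    refine ⟨u, u', hu, by rw [hz]; exact h1, fun v v' hv => ?_⟩
    have h := hW.integrable_form_and_eq h1 h2 hv.embed_toH10 hv.deriv_toH10
    exact ⟨h.1, by rw [h.2, hq, hinner _ v q.2 hv.embed_toH10]⟩

theorem schrodingerForm_eq (hW : IsFormBounded W k) {z : h10 Γ} {u u' : Γ.Point → ℂ}
    (h1 : h10Embed Γ z =ᵐ[volume] u) (h2 : h10Deriv Γ z =ᵐ[volume] u') :
    schrodingerForm W u u' = ‖h10Deriv Γ z‖ ^ 2 - ‖hW.mulSqrt z‖ ^ 2 := by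
  have h := (hW.integrable_form_and_eq h1 h2 h1 h2).2
  have e : ∀ x, u' x * conj (u' x) - W x * (u x * conj (u x)) =
      ((‖u' x‖ ^ 2 - W x * ‖u x‖ ^ 2 : ℝ) : ℂ) := by
    intro x
    rw [Complex.mul_conj, Complex.mul_conj, Complex.normSq_eq_norm_sq, Complex.normSq_eq_norm_sq]
    push_cast
    rfl
  simp only [e] at h
  rw [integral_complex_ofReal] at h
  simp only [inner_self_eq_norm_sq_to_K] at h
  exact Complex.ofReal_injective (h.trans (by push_cast; rfl))

/-- For closedness, coercivity upgrades form-Cauchy plus `L₂` convergence to Cauchy in the norm of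
`H^{1,0}`, which is complete. -/
theorem isClosedSemiboundedForm (hW : IsFormBounded W k) : IsClosedSemiboundedForm W := by
  refine ⟨fun u u' hu => ?_, ⟨-k, fun u u' hu => ?_⟩, fun u u' f hu hf hform => ?_⟩
  · have h := (memLp_two_iff_integrable_sq_norm (hW.memLp hu).1).1 (hW.memLp hu)
    refine h.congr (Eventually.of_forall fun x => ?_)
    simp only
    rw [norm_mul, mul_pow, Complex.norm_real, Real.norm_eq_abs, sq_abs, Real.sq_sqrt (hW.nonneg x)]
  · rw [hW.schrodingerForm_eq hu.embed_toH10 hu.deriv_toH10]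
    have h1 : ∫ x, ‖u x‖ ^ 2 = ‖h10Embed Γ hu.toH10‖ ^ 2 := by
      have h2 : ENNReal.ofReal (∫ x, ‖u x‖ ^ 2) = ‖h10Embed Γ hu.toH10‖ₑ ^ 2 := by
        rw [← lintegral_enorm_sq_eq hu.embed_toH10, ofReal_integral_eq_lintegral_ofReal
          ((memLp_two_iff_integrable_sq_norm hu.memLp.1).1 hu.memLp)
          (Eventually.of_forall fun x => by positivity)]
        simp only [ENNReal.ofReal_pow (norm_nonneg _), ofReal_norm]
      rw [← ofReal_norm, ← ENNReal.ofReal_pow (norm_nonneg _)] at h2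
      exact (ENNReal.ofReal_eq_ofReal_iff (integral_nonneg fun x => by positivity)
        (by positivity)).1 h2
    have h3 : ‖hW.mulSqrt hu.toH10‖ ^ 2 ≤ _ := hW.norm_mulSqrtₗ_sq_le hu.toH10
    rw [h1]
    nlinarith [sq_nonneg ‖h10Deriv Γ hu.toH10‖]
  · let z : ℕ → h10 Γ := fun n => (hu n).toH10
    have hJ : Tendsto (fun n => h10Embed Γ (z n)) atTop (𝓝 f) := by
      rw [Lp.tendsto_Lp_iff_tendsto_eLpNorm']
      refine hf.congr fun n => eLpNorm_congr_ae ?_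
      filter_upwards [(hu n).embed_toH10] with x hx
      rw [Pi.sub_apply, hx]
    have hsub : ∀ (y : h10 Γ) {v v' : Γ.Point → ℂ} (n : ℕ), h10Embed Γ y =ᵐ[volume] v →
        h10Deriv Γ y =ᵐ[volume] v' →
        schrodingerForm W (u n - v) (u' n - v') =
          ‖h10Deriv Γ (z n - y)‖ ^ 2 - ‖hW.mulSqrt (z n - y)‖ ^ 2 := by
      intro y v v' n h1 h2
      refine hW.schrodingerForm_eq ?_ ?_
      · rw [map_sub]
        exact (Lp.coeFn_sub _ _).trans ((hu n).embed_toH10.sub h1)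
      · rw [map_sub]
        exact (Lp.coeFn_sub _ _).trans ((hu n).deriv_toH10.sub h2)
    have hcau : CauchySeq z := by
      rw [cauchySeq_iff_tendsto_dist_atTop_0]
      have hJ0 : Tendsto (fun q : ℕ × ℕ => ‖h10Embed Γ (z q.1 - z q.2)‖) atTop (𝓝 0) := by
        have := (cauchySeq_iff_tendsto_dist_atTop_0).1 hJ.cauchySeq
        simpa only [dist_eq_norm, map_sub] using this
      have h4 : Tendsto (fun q : ℕ × ℕ =>
          4 * (schrodingerForm W (u q.1 - u q.2) (u' q.1 - u' q.2) +
            (k + 1) * ‖h10Embed Γ (z q.1 - z q.2)‖ ^ 2)) atTop (𝓝 0) := by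
        have := (hform.add ((hJ0.pow 2).const_mul (k + 1))).const_mul 4
        simpa using this
      have h5 : Tendsto (fun q : ℕ × ℕ => ‖z q.1 - z q.2‖ ^ 2) atTop (𝓝 0) := by
        refine squeeze_zero (fun _ => by positivity) (fun q => ?_) h4
        rw [hsub (z q.2) q.1 (hu q.2).embed_toH10 (hu q.2).deriv_toH10]
        linarith [hW.coercive (z q.1 - z q.2)]
      have h6 := h5.sqrt
      simp only [Real.sqrt_sq (norm_nonneg _), Real.sqrt_zero] at h6
      simpa only [dist_eq_norm] using h6
    obtain ⟨ζ, hζ⟩ := cauchySeq_tendsto_of_complete hcau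
    obtain ⟨w, w', hw, h1, h2⟩ := exists_memH10 ζ
    refine ⟨w, w', hw, ?_, ?_⟩
    · rw [tendsto_nhds_unique hJ (((h10Embed Γ).continuous.tendsto ζ).comp hζ)]
      exact h1
    · simp only [hsub ζ _ h1 h2]
      have hc : Continuous fun y : h10 Γ =>
          ‖h10Deriv Γ (y - ζ)‖ ^ 2 - ‖hW.mulSqrt (y - ζ)‖ ^ 2 := by fun_prop
      have h3 := (hc.tendsto ζ).comp hζ
      simpa [Function.comp_def] using h3

theorem exists_isResolventGraph (hW : IsFormBounded W k) :
    ∃ R : L2 Γ →L[ℂ] L2 Γ, IsResolventGraph (schrodingerGraph W) R (k + 1) :=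
  _root_.exists_isResolventGraph (h10Embed Γ) (h10Deriv Γ) hW.mulSqrt denseRange_h10Embed
    h10Embed_injective (by norm_num) hW.coercive _ hW.schrodingerGraph_eq

end IsFormBounded

/-! ### Splitting the potential and bounding the dimension -/

theorem MemH10.sum {ι : Type*} (s : Finset ι) {u u' : ι → Γ.Point → ℂ}
    (h : ∀ i, MemH10 (u i) (u' i)) (c : ι → ℂ) :
    MemH10 (∑ i ∈ s, c i • u i) (∑ i ∈ s, c i • u' i) := by
  classical
  induction s using Finset.induction_on with
  | empty => simpa using MemH10.zero
  | insert a s ha ih =>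
    rw [Finset.sum_insert ha, Finset.sum_insert ha]
    exact ((h a).smul (c a)).add ih

/-- Let `S` be the sum. The function `v = ∑ conj(u_i(x)) u_i` has `v(x) = S` and, by orthonormality,
energy `S`; the pointwise estimate gives `S² ≤ |x| S`. -/
theorem sum_sq_le_height {ι : Type*} [Fintype ι] {z : ι → h10 Γ}
    (hz : Orthonormal ℂ fun i => h10Deriv Γ (z i)) {u u' : ι → Γ.Point → ℂ}
    (hu : ∀ i, MemH10 (u i) (u' i)) (h2 : ∀ i, h10Deriv Γ (z i) =ᵐ[volume] u' i) (x : Γ.Point) :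
    ∑ i, ‖u i x‖ ^ 2 ≤ x.height := by
  set S := ∑ i, ‖u i x‖ ^ 2 with hS
  have hS0 : 0 ≤ S := Finset.sum_nonneg fun _ _ => by positivity
  have hv := MemH10.sum Finset.univ hu fun i => conj (u i x)
  have hw : (∑ i, conj (u i x) • h10Deriv Γ (z i) : L2 Γ) =ᵐ[volume]
      ∑ i, conj (u i x) • u' i := by
    refine (Lp.coeFn_finsetSum _ _).trans ?_
    have : ∀ᵐ y, ∀ i, (conj (u i x) • h10Deriv Γ (z i) : L2 Γ) y = (conj (u i x) • u' i) y := by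
      refine ae_all_iff.2 fun i => ?_
      filter_upwards [Lp.coeFn_smul (conj (u i x)) (h10Deriv Γ (z i)), h2 i] with y h3 h4
      rw [h3, Pi.smul_apply, h4, Pi.smul_apply]
    filter_upwards [this] with y hy
    simp only [Finset.sum_apply, hy]
  have h := hv.norm_le hw x
  have e1 : (∑ i, conj (u i x) • u i) x = (S : ℂ) := by
    rw [Finset.sum_apply, hS, Complex.ofReal_sum]
    refine Finset.sum_congr rfl fun i _ => ?_
    rw [Pi.smul_apply, smul_eq_mul, mul_comm, Complex.mul_conj, Complex.normSq_eq_norm_sq]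
  have e2 : ‖(∑ i, conj (u i x) • h10Deriv Γ (z i) : L2 Γ)‖ ^ 2 = S := by
    have h3 := hz.inner_sum (fun i => conj (u i x)) (fun i => conj (u i x)) Finset.univ
    rw [inner_self_eq_norm_sq_to_K] at h3
    have h4 : ∑ i, conj (conj (u i x)) * conj (u i x) = (S : ℂ) := by
      rw [hS, Complex.ofReal_sum]
      refine Finset.sum_congr rfl fun i _ => ?_
      rw [Complex.conj_conj, Complex.mul_conj, Complex.normSq_eq_norm_sq]
    rw [h4] at h3
    exact Complex.ofReal_injective ((by push_cast; rfl : _ = _).trans h3)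
  rw [e1, Complex.norm_real, Real.norm_of_nonneg hS0] at h
  have h5 : S ^ 2 ≤ x.height * S := by
    calc S ^ 2 ≤ (√x.height * ‖(∑ i, conj (u i x) • h10Deriv Γ (z i) : L2 Γ)‖) ^ 2 := by gcongr
      _ = x.height * S := by rw [mul_pow, e2, Real.sq_sqrt x.height_nonneg]
  rcases hS0.eq_or_lt with h0 | h0
  · rw [← h0]; exact x.height_nonneg
  · nlinarith

/-- `W = W₁ + W₂`, where `∫ W₁ |u|² ≤ ½ ∫ |u'|²` and `W₂` is integrable with weight `|x|`. -/
structure IsSplitting (W W₁ W₂ : Γ.Point → ℝ) : Prop where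
  eq_add : ∀ x, W x = W₁ x + W₂ x
  nonneg₁ : ∀ x, 0 ≤ W₁ x
  nonneg₂ : ∀ x, 0 ≤ W₂ x
  aemeasurable₁ : AEMeasurable W₁ volume
  aemeasurable₂ : AEMeasurable W₂ volume
  hardy : ∀ u u' : Γ.Point → ℂ, MemH10 u u' →
    ∫⁻ x, ENNReal.ofReal (W₁ x) * ‖u x‖ₑ ^ 2 ≤ 2⁻¹ * ∫⁻ x, ‖u' x‖ₑ ^ 2
  finite : ∫⁻ x, ENNReal.ofReal (x.height * W₂ x) ≠ ∞

namespace IsSplitting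

variable {W W₁ W₂ : Γ.Point → ℝ}

theorem lintegral_eq (hS : IsSplitting W W₁ W₂) {u u' : Γ.Point → ℂ} (hu : MemH10 u u') :
    ∫⁻ x, ENNReal.ofReal (W x) * ‖u x‖ₑ ^ 2 = (∫⁻ x, ENNReal.ofReal (W₁ x) * ‖u x‖ₑ ^ 2) +
      ∫⁻ x, ENNReal.ofReal (W₂ x) * ‖u x‖ₑ ^ 2 := by
  rw [← lintegral_add_left' (f := fun x => ENNReal.ofReal (W₁ x) * ‖u x‖ₑ ^ 2) (hS.aemeasurable₁.ennreal_ofReal.mul (hu.memLp.1.enorm.pow_const 2))]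
  refine lintegral_congr fun x => ?_
  rw [hS.eq_add, ENNReal.ofReal_add (hS.nonneg₁ x) (hS.nonneg₂ x), add_mul]

/-- Since `|x| W₂` is integrable, its integral over `{W₂ > n}` is below 1/4 for some `n`. The
pointwise estimate then bounds that part of the potential by a quarter of the energy, the rest of
`W₂` is at most `n`, and `W₁` uses the remaining half of the 3/4. -/
theorem exists_isFormBounded (hS : IsSplitting W W₁ W₂) : ∃ k, IsFormBounded W k := by
  let F : ℕ → Γ.Point → ℝ≥0∞ := fun n =>
    indicator {x | (n : ℝ) < W₂ x} fun x => ENNReal.ofReal (x.height * W₂ x)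
  have hm : AEMeasurable (fun x : Γ.Point => ENNReal.ofReal (x.height * W₂ x)) volume :=
    (measurable_height.aemeasurable.mul hS.aemeasurable₂).ennreal_ofReal
  have hF : ∀ n, AEMeasurable (F n) volume := fun n =>
    hm.indicator₀ (nullMeasurableSet_lt aemeasurable_const hS.aemeasurable₂)
  have hlim : Tendsto (fun n => ∫⁻ x, F n x) atTop (𝓝 (∫⁻ _ : Γ.Point, 0)) := by
    refine tendsto_lintegral_of_dominated_convergence' _ hF (fun n => Eventually.of_forall fun x =>
      indicator_le_self _ _ x) hS.finite (Eventually.of_forall fun x => ?_)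
    refine tendsto_const_nhds.congr' ?_
    obtain ⟨N, hN⟩ := exists_nat_ge (W₂ x)
    filter_upwards [eventually_ge_atTop N] with n hn
    refine (indicator_of_notMem ?_ _).symm
    have : (N : ℝ) ≤ n := by exact_mod_cast hn
    simp only [mem_ofPred_eq, not_lt]
    exact hN.trans this
  rw [lintegral_zero] at hlim
  obtain ⟨n, hn⟩ := (hlim.eventually (gt_mem_nhds
    (show (0 : ℝ≥0∞) < ENNReal.ofReal (1 / 4) by simp))).exists
  refine ⟨n, ?_, fun x => ?_, n.cast_nonneg, fun u u' hu => ?_⟩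
  · rw [funext hS.eq_add]
    exact hS.aemeasurable₁.add hS.aemeasurable₂
  · rw [hS.eq_add]
    exact add_nonneg (hS.nonneg₁ x) (hS.nonneg₂ x)
  · set D := ∫⁻ x, ‖u' x‖ₑ ^ 2 with hD
    have h2 : ∫⁻ x, ENNReal.ofReal (W₂ x) * ‖u x‖ₑ ^ 2 ≤
        ENNReal.ofReal (1 / 4) * D + ENNReal.ofReal n * ∫⁻ x, ‖u x‖ₑ ^ 2 := by
      calc ∫⁻ x, ENNReal.ofReal (W₂ x) * ‖u x‖ₑ ^ 2
          ≤ ∫⁻ x, (F n x * D + ENNReal.ofReal n * ‖u x‖ₑ ^ 2) := by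
            refine lintegral_mono fun x => ?_
            by_cases hx : (n : ℝ) < W₂ x
            · have h3 : F n x = ENNReal.ofReal (x.height * W₂ x) := indicator_of_mem (s := {x | (n : ℝ) < W₂ x}) hx _
              refine le_trans ?_ le_self_add
              rw [h3, ENNReal.ofReal_mul x.height_nonneg, mul_comm (ENNReal.ofReal x.height),
                mul_assoc]
              gcongr
              exact hu.enorm_sq_le x
            · refine le_trans ?_ le_add_self
              gcongr
              exact not_lt.1 hx
        _ = (∫⁻ x, F n x) * D + ENNReal.ofReal n * ∫⁻ x, ‖u x‖ₑ ^ 2 := by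
            rw [lintegral_add_left' ((hF n).mul_const D), lintegral_mul_const'' _ (hF n),
              lintegral_const_mul'' _ (hu.memLp.1.enorm.pow_const 2)]
        _ ≤ _ := by gcongr
    rw [hS.lintegral_eq hu]
    refine (add_le_add (hS.hardy u u' hu) h2).trans (le_of_eq ?_)
    rw [← add_assoc, ← add_mul]
    congr 2
    rw [show (2 : ℝ≥0∞)⁻¹ = ENNReal.ofReal (1 / 2) by
      rw [one_div, ENNReal.ofReal_inv_of_pos two_pos]; simp,
      ← ENNReal.ofReal_add (by norm_num) (by norm_num)]
    norm_num

/-- On a subspace of dimension `n` where the form is negative, `n ≤ 2 ∫ |x| W₂ dx`. -/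
theorem card_le (hS : IsSplitting W W₁ W₂) {k : ℝ} (hW : IsFormBounded W k) (ι : Type) [Fintype ι]
    (y : ι → h10 Γ) (hy : ∀ a : ι → ℂ, a ≠ 0 →
      ‖h10Deriv Γ (∑ i, a i • y i)‖ ^ 2 < ‖hW.mulSqrt (∑ i, a i • y i)‖ ^ 2) :
    (Fintype.card ι : ℝ≥0∞) ≤ 2 * ∫⁻ x, ENNReal.ofReal (x.height * W₂ x) := by
  classical
  let Y : (ι → ℂ) →ₗ[ℂ] h10 Γ := Fintype.linearCombination ℂ y
  have hY : ∀ a, Y a = ∑ i, a i • y i := fun a => Fintype.linearCombination_apply ℂ y a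
  let T : (ι → ℂ) →ₗ[ℂ] L2 Γ := (h10Deriv Γ : h10 Γ →ₗ[ℂ] L2 Γ).comp Y
  have hT : ∀ a, T a = h10Deriv Γ (Y a) := fun a => rfl
  -- Zero energy forces the function to vanish everywhere by the pointwise estimate, which
  -- contradicts strict negativity of the form. So passing to derivatives loses no dimension.
  have hTinj : Function.Injective T := by
    rw [injective_iff_map_eq_zero]
    intro a ha
    by_contra h0
    have h1 := hy a h0
    rw [← hY] at h1
    obtain ⟨u, u', hu, h2, h3⟩ := exists_memH10 (Y a)
    have h4 : ∀ x, u x = 0 := fun x => by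
      have := hu.norm_le h3 x
      rw [← hT, ha, norm_zero, mul_zero] at this
      exact norm_le_zero_iff.1 this
    have h5 := hW.enorm_mulSqrt_sq h2
    simp only [h4, enorm_zero, ne_eq, OfNat.ofNat_ne_zero, not_false_eq_true, zero_pow, mul_zero,
      lintegral_zero, pow_eq_zero_iff, enorm_eq_zero] at h5
    rw [h5, norm_zero, zero_pow two_ne_zero] at h1
    exact absurd h1 (not_lt.2 (by positivity))
  have hrank : Module.finrank ℂ (LinearMap.range T) = Fintype.card ι := by
    rw [LinearMap.finrank_range_of_inj hTinj, Module.finrank_fintype_fun_eq_card]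
  let b := stdOrthonormalBasis ℂ (LinearMap.range T)
  choose a ha using fun j => (b j).2
  let z := fun j => Y (a j)
  have hz : Orthonormal ℂ fun j => h10Deriv Γ (z j) := by
    have h1 := b.orthonormal.comp_linearIsometry (LinearMap.range T).subtypeₗᵢ
    convert h1 using 1
    funext j
    exact ha j
  have hza : ∀ j, a j ≠ 0 := fun j h0 => by
    have := hz.1 j
    simp only [z, h0, map_zero, norm_zero, zero_ne_one] at this
  choose u u' hu h1 h2 using fun j => exists_memH10 (z j)
  -- With energy normalized to 1, negativity gives `∫ W|u_j|² ≥ 1`, of which `W₁` accounts for at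
  -- most half.
  have hhalf : ∀ j, (2 : ℝ≥0∞)⁻¹ ≤ ∫⁻ x, ENNReal.ofReal (W₂ x) * ‖u j x‖ₑ ^ 2 := by
    intro j
    have h3 := hy (a j) (hza j)
    rw [← hY] at h3
    have h4 : ‖h10Deriv Γ (z j)‖ = 1 := hz.1 j
    have h5 : (1 : ℝ≥0∞) ≤ ‖hW.mulSqrt (z j)‖ₑ ^ 2 := by
      change ‖h10Deriv Γ (z j)‖ ^ 2 < ‖hW.mulSqrt (z j)‖ ^ 2 at h3
      rw [h4, one_pow] at h3
      rw [← ofReal_norm, ← ENNReal.ofReal_pow (norm_nonneg _), ← ENNReal.ofReal_one]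
      exact ENNReal.ofReal_le_ofReal h3.le
    have h6 := hS.hardy _ _ (hu j)
    rw [lintegral_enorm_sq_eq (h2 j), ← ofReal_norm, h4, ENNReal.ofReal_one, one_pow, mul_one] at h6
    rw [hW.enorm_mulSqrt_sq (h1 j), hS.lintegral_eq (hu j), ← ENNReal.inv_two_add_inv_two] at h5
    exact (ENNReal.add_le_add_iff_left (a := 2⁻¹) (by simp)).1 (h5.trans (add_le_add h6 le_rfl))
  have hsum : (Fintype.card ι : ℝ≥0∞) * 2⁻¹ ≤ ∫⁻ x, ENNReal.ofReal (x.height * W₂ x) := by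
    calc (Fintype.card ι : ℝ≥0∞) * 2⁻¹
        = ∑ _j : Fin (Module.finrank ℂ (LinearMap.range T)), (2 : ℝ≥0∞)⁻¹ := by
          rw [Finset.sum_const, Finset.card_univ, Fintype.card_fin, hrank, nsmul_eq_mul]
      _ ≤ ∑ j, ∫⁻ x, ENNReal.ofReal (W₂ x) * ‖u j x‖ₑ ^ 2 := Finset.sum_le_sum fun j _ => hhalf j
      _ = ∫⁻ x, ∑ j, ENNReal.ofReal (W₂ x) * ‖u j x‖ₑ ^ 2 :=
          (lintegral_finsetSum' _ fun j _ =>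
            hS.aemeasurable₂.ennreal_ofReal.mul ((hu j).memLp.1.enorm.pow_const 2)).symm
      _ ≤ _ := by
          refine lintegral_mono fun x => ?_
          rw [← Finset.mul_sum, mul_comm x.height, ENNReal.ofReal_mul (hS.nonneg₂ x)]
          gcongr
          refine le_trans (le_of_eq ?_) (ENNReal.ofReal_le_ofReal (sum_sq_le_height hz hu h2 x))
          rw [ENNReal.ofReal_sum_of_nonneg fun _ _ => by positivity]
          refine Finset.sum_congr rfl fun j _ => ?_
          rw [ENNReal.ofReal_pow (norm_nonneg _), ofReal_norm]
  calc (Fintype.card ι : ℝ≥0∞) = 2 * ((Fintype.card ι : ℝ≥0∞) * 2⁻¹) := by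
        rw [mul_comm, mul_assoc, ENNReal.inv_mul_cancel two_ne_zero ENNReal.ofNat_ne_top, mul_one]
    _ ≤ _ := by gcongr

theorem spectral_bounds (hS : IsSplitting W W₁ W₂) : HasFiniteNegativeSpectrum W ∧
    negEigenvalueCount (schrodinger W) ≤ 2 * ∫⁻ x, ENNReal.ofReal (x.height * W₂ x) := by
  obtain ⟨k, hW⟩ := hS.exists_isFormBounded
  obtain ⟨R, hR⟩ := hW.exists_isResolventGraph
  have hneg := negativeFamiliesBounded_of_form hW.schrodingerGraph_eq
    (N := 2 * ∫⁻ x, ENNReal.ofReal (x.height * W₂ x)) fun ι _ y hy => hS.card_le hW ι y hy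
  exact ⟨⟨hW.isClosedSemiboundedForm, hR.graph_eq, hR.isSelfAdjoint, hR.finite_negative_spectrum
    (ENNReal.mul_ne_top ENNReal.ofNat_ne_top hS.finite) hneg⟩, hR.negEigenvalueCount_le hneg⟩

end IsSplitting

end RegularTree
end

/-! ### Tail integrals of distribution functions -/

noncomputable section

section Tail

theorem lintegral_Ioi_rpow_neg {p t : ℝ} (hp : 1 < p) (ht : 0 < t) :
    ∫⁻ s in Ioi t, ENNReal.ofReal (s ^ (-p)) = ENNReal.ofReal (t ^ (1 - p) / (p - 1)) := by
  rw [← ofReal_integral_eq_lintegral_ofReal (integrableOn_Ioi_rpow_of_lt (by linarith) ht),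
    integral_Ioi_rpow_of_lt (by linarith) ht]
  · congr 1
    rw [show -p + 1 = -(p - 1) by ring, neg_div_neg_eq, show -(p - 1) = 1 - p by ring]
  · filter_upwards [ae_restrict_mem measurableSet_Ioi] with s hs
    exact Real.rpow_nonneg (ht.le.trans (le_of_lt hs)) _

theorem le_mul_rpow_neg {p s : ℝ} (hs : 0 < s) {a M : ℝ≥0∞}
    (h : ENNReal.ofReal (s ^ p) * a ≤ M) : a ≤ M * ENNReal.ofReal (s ^ (-p)) := by
  have hsp : 0 < s ^ p := Real.rpow_pos_of_pos hs p
  rw [Real.rpow_neg hs.le, ENNReal.ofReal_inv_of_pos hsp, ← div_eq_mul_inv,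
    ENNReal.le_div_iff_mul_le (Or.inl (by simpa using hsp)) (Or.inl ENNReal.ofReal_ne_top), mul_comm]
  exact h

/-- The constant `2 ^ p / (p - 1)`. -/
def tailConst (p : ℝ) : ℝ≥0 := Real.toNNReal (2 ^ p / (p - 1))

/-- The constant arises at the cut-off `1/(2α)`: `2α · (2α)^(p-1)/(p-1) = 2^p α^p/(p-1)`. -/
theorem two_mul_tail {p α : ℝ} (hp : 1 < p) (hα : 0 < α) (M : ℝ≥0∞) :
    2 * ENNReal.ofReal α * (M * ENNReal.ofReal (((2 * α)⁻¹) ^ (1 - p) / (p - 1))) =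
      tailConst p * ENNReal.ofReal (α ^ p) * M := by
  have h0 : (tailConst p : ℝ≥0∞) = ENNReal.ofReal (2 ^ p / (p - 1)) := rfl
  have h2 : (2 : ℝ≥0∞) = ENNReal.ofReal 2 := by simp
  have h1 : ENNReal.ofReal 2 * ENNReal.ofReal α *
      ENNReal.ofReal (((2 * α)⁻¹) ^ (1 - p) / (p - 1)) =
      ENNReal.ofReal (2 ^ p / (p - 1)) * ENNReal.ofReal (α ^ p) := by
    have hp1 : 0 < p - 1 := by linarith
    rw [← ENNReal.ofReal_mul (by norm_num), ← ENNReal.ofReal_mul (by positivity),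
      ← ENNReal.ofReal_mul (by positivity)]
    congr 1
    rw [Real.inv_rpow (by positivity), ← Real.rpow_neg (by positivity), neg_sub,
      div_mul_eq_mul_div, ← Real.mul_rpow (by norm_num) hα.le, Real.rpow_sub_one (by positivity)]
    field_simp
  rw [h0, ← h1, h2]
  ring

variable {p : ℝ} {ν N : ℝ → ℝ≥0∞} {M : ℝ≥0∞}

theorem lintegral_tail_le (hp : 1 < p) {t : ℝ} (ht : 0 < t)
    (hν : ∀ s, 0 < s → ENNReal.ofReal (s ^ p) * ν s ≤ M) :
    ∫⁻ s in Ioi t, ν s ≤ M * ENNReal.ofReal (t ^ (1 - p) / (p - 1)) := by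
  calc ∫⁻ s in Ioi t, ν s ≤ ∫⁻ s in Ioi t, M * ENNReal.ofReal (s ^ (-p)) :=
        setLIntegral_mono' measurableSet_Ioi fun s hs => le_mul_rpow_neg (ht.trans hs)
          (hν s (ht.trans hs))
    _ = _ := by
        rw [lintegral_const_mul _ (by fun_prop), lintegral_Ioi_rpow_neg hp ht]

theorem le_of_tail (hp : 1 < p) (hν : ∀ s, 0 < s → ENNReal.ofReal (s ^ p) * ν s ≤ M)
    (hN : ∀ α, 0 < α → N α ≤ 2 * (ENNReal.ofReal α * ∫⁻ s in Ioi (2 * α)⁻¹, ν s)) {α : ℝ}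
    (hα : 0 < α) : N α ≤ tailConst p * ENNReal.ofReal (α ^ p) * M := by
  rw [← two_mul_tail hp hα, mul_assoc]
  refine (hN α hα).trans ?_
  gcongr
  exact lintegral_tail_le hp (by positivity) hν

/-- Below a small `ε` the integrand is at most `L s^(-p)` for any `L` above the limsup at zero.
Above it the integral is a finite constant, whose contribution `O(α)` is negligible against `α^p`
because `p > 1`. -/
theorem limsup_le_of_tail (hp : 1 < p) (hM : M ≠ ∞)
    (hν : ∀ s, 0 < s → ENNReal.ofReal (s ^ p) * ν s ≤ M)
    (hN : ∀ α, 0 < α → N α ≤ 2 * (ENNReal.ofReal α * ∫⁻ s in Ioi (2 * α)⁻¹, ν s)) :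
    limsup (fun α : ℝ => N α / ENNReal.ofReal (α ^ p)) atTop ≤
      tailConst p * limsup (fun s : ℝ => ENNReal.ofReal (s ^ p) * ν s) (𝓝[>] 0) := by
  have hC0 : (tailConst p : ℝ≥0∞) ≠ 0 := by
    have : 0 < 2 ^ p / (p - 1) := div_pos (by positivity) (by linarith)
    simpa [tailConst] using this
  suffices h : ∀ L, limsup (fun s : ℝ => ENNReal.ofReal (s ^ p) * ν s) (𝓝[>] 0) < L →
      limsup (fun α : ℝ => N α / ENNReal.ofReal (α ^ p)) atTop ≤ tailConst p * L by
    have h1 : limsup (fun α : ℝ => N α / ENNReal.ofReal (α ^ p)) atTop / tailConst p ≤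
        limsup (fun s : ℝ => ENNReal.ofReal (s ^ p) * ν s) (𝓝[>] 0) := by
      refine le_of_forall_gt_imp_ge_of_dense fun L hL => ?_
      rw [ENNReal.div_le_iff hC0 ENNReal.coe_ne_top, mul_comm]
      exact h L hL
    rwa [ENNReal.div_le_iff hC0 ENNReal.coe_ne_top, mul_comm] at h1
  intro L hL
  obtain ⟨ε, hε, hsub⟩ := mem_nhdsGT_iff_exists_Ioo_subset.1 (eventually_lt_of_limsup_lt hL)
  replace hε : 0 < ε := hε
  set B := ∫⁻ s in Ioi (ε / 2), ν s with hB
  have hBtop : B ≠ ∞ := ne_top_of_le_ne_top (ENNReal.mul_ne_top hM ENNReal.ofReal_ne_top)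
    (lintegral_tail_le hp (by positivity) hν)
  have hbound : ∀ α, 0 < α → N α / ENNReal.ofReal (α ^ p) ≤
      tailConst p * L + 2 * B * ENNReal.ofReal (α ^ (1 - p)) := by
    intro α hα
    have ht : 0 < (2 * α)⁻¹ := by positivity
    have hαp : 0 < α ^ p := Real.rpow_pos_of_pos hα p
    have h1 : ∫⁻ s in Ioi (2 * α)⁻¹, ν s ≤
        L * ENNReal.ofReal (((2 * α)⁻¹) ^ (1 - p) / (p - 1)) + B := by
      calc ∫⁻ s in Ioi (2 * α)⁻¹, ν s
          -- The pieces overlap on purpose: `ε / 2` allows an open half-line to cover the point `ε`.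
          ≤ ∫⁻ s in (Ioi (2 * α)⁻¹ ∩ Iio ε) ∪ Ioi (ε / 2), ν s := by
            refine lintegral_mono_set fun s hs => ?_
            rcases lt_or_ge s ε with h | h
            · exact Or.inl ⟨hs, h⟩
            · exact Or.inr (lt_of_lt_of_le (by linarith) h)
        _ ≤ (∫⁻ s in Ioi (2 * α)⁻¹ ∩ Iio ε, ν s) + B := lintegral_union_le _ _ _
        _ ≤ (∫⁻ s in Ioi (2 * α)⁻¹ ∩ Iio ε, L * ENNReal.ofReal (s ^ (-p))) + B := by
            gcongr ?_ + _
            refine setLIntegral_mono' (measurableSet_Ioi.inter measurableSet_Iio) fun s hs => ?_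
            exact le_mul_rpow_neg (ht.trans hs.1) (le_of_lt (hsub ⟨ht.trans hs.1, hs.2⟩))
        _ ≤ (∫⁻ s in Ioi (2 * α)⁻¹, L * ENNReal.ofReal (s ^ (-p))) + B := by
            gcongr
            exact inter_subset_left
        _ = _ := by
            rw [lintegral_const_mul _ (by fun_prop), lintegral_Ioi_rpow_neg hp ht]
    rw [ENNReal.div_le_iff (by simpa using hαp) ENNReal.ofReal_ne_top, add_mul]
    have h2 : ENNReal.ofReal (α ^ (1 - p)) * ENNReal.ofReal (α ^ p) = ENNReal.ofReal α := by
      rw [← ENNReal.ofReal_mul (by positivity), ← Real.rpow_add hα, sub_add_cancel, Real.rpow_one]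
    calc N α ≤ 2 * (ENNReal.ofReal α *
          (L * ENNReal.ofReal (((2 * α)⁻¹) ^ (1 - p) / (p - 1)) + B)) :=
          (hN α hα).trans (by gcongr)
      _ = 2 * ENNReal.ofReal α * (L * ENNReal.ofReal (((2 * α)⁻¹) ^ (1 - p) / (p - 1))) +
          2 * B * ENNReal.ofReal α := by ring
      _ = _ := by
          rw [two_mul_tail hp hα, mul_assoc (2 * B), h2]
          ring
  have hlim : Tendsto (fun α : ℝ => tailConst p * L + 2 * B * ENNReal.ofReal (α ^ (1 - p))) atTop
      (𝓝 (tailConst p * L + 2 * B * 0)) := by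
    refine tendsto_const_nhds.add (ENNReal.Tendsto.const_mul ?_
      (Or.inr (ENNReal.mul_ne_top ENNReal.ofNat_ne_top hBtop)))
    have h3 := tendsto_rpow_neg_atTop (y := p - 1) (by linarith)
    rw [neg_sub] at h3
    simpa using ENNReal.tendsto_ofReal h3
  rw [mul_zero, add_zero] at hlim
  rw [← hlim.limsup_eq]
  refine limsup_le_limsup ?_
  filter_upwards [eventually_gt_atTop 0] with α hα using hbound α hα

/-- Layer cake formula for the positive part of `f - t`, followed by a translation by `t`;
`ENNReal.ofReal` takes the positive part. -/
theorem lintegral_sub_pos_eq {X : Type*} [MeasurableSpace X] {μ : Measure X} {f : X → ℝ}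
    (hf : AEMeasurable f μ) (t : ℝ) :
    ∫⁻ x, ENNReal.ofReal (f x - t) ∂μ = ∫⁻ s in Ioi t, μ {x | s < f x} := by
  have h1 : ∫⁻ x, ENNReal.ofReal (f x - t) ∂μ = ∫⁻ x, ENNReal.ofReal (max (f x - t) 0) ∂μ :=
    lintegral_congr fun x => by rw [ENNReal.ofReal_max]; simp
  rw [h1, lintegral_eq_lintegral_meas_lt (f := fun x => max (f x - t) 0) μ (Eventually.of_forall fun x => le_max_right _ _)
    ((hf.sub_const t).max aemeasurable_const)]
  have h2 := (measurePreserving_add_right (volume : Measure ℝ) t).setLIntegral_comp_preimage_emb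
    (MeasurableEquiv.addRight t).measurableEmbedding (fun s => μ {x | s < f x}) (Ioi t)
  rw [← h2]
  have h3 : (fun s : ℝ => s + t) ⁻¹' Ioi t = Ioi 0 := by
    ext s; simp
  rw [h3]
  refine setLIntegral_congr_fun measurableSet_Ioi fun s hs => ?_
  have hs0 : 0 < s := hs
  congr 1
  ext x
  simp only [mem_ofPred_eq, lt_max_iff, not_lt.2 hs0.le, or_false]
  constructor <;> intro h <;> linarith

/-- Chebyshev's inequality. -/
theorem rpow_mul_meas_le {X : Type*} [MeasurableSpace X] {μ : Measure X} {f : X → ℝ}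
    (hf : AEMeasurable f μ) (hp : 0 < p) {s : ℝ} (hs : 0 < s) :
    ENNReal.ofReal (s ^ p) * μ {x | s < f x} ≤ ∫⁻ x, ENNReal.ofReal (f x ^ p) ∂μ := by
  refine le_trans ?_ (mul_meas_ge_le_lintegral₀ (hf.pow_const p).ennreal_ofReal
    (ENNReal.ofReal (s ^ p)))
  have hsub : {x | s < f x} ⊆ {x | ENNReal.ofReal (s ^ p) ≤ ENNReal.ofReal (f x ^ p)} :=
    fun x hx => ENNReal.ofReal_le_ofReal (Real.rpow_le_rpow hs.le (le_of_lt hx) hp.le)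
  exact mul_le_mul_right (measure_mono hsub) _

/-- The expression is the integral of `s^p` over `{s < f}`; the integrand is dominated by `f^p` and
tends to zero pointwise with `s^p`. -/
theorem tendsto_rpow_mul_meas {X : Type*} [MeasurableSpace X] {μ : Measure X} {f : X → ℝ}
    (hf : AEMeasurable f μ) (hp : 0 < p) (hfin : ∫⁻ x, ENNReal.ofReal (f x ^ p) ∂μ ≠ ∞) :
    Tendsto (fun s : ℝ => ENNReal.ofReal (s ^ p) * μ {x | s < f x}) (𝓝[>] 0) (𝓝 0) := by
  wlog hm : Measurable f generalizing f
  · have he := hf.ae_eq_mk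
    have h := this hf.measurable_mk.aemeasurable
      (by rwa [lintegral_congr_ae (g := fun x => ENNReal.ofReal (f x ^ p))
        (by filter_upwards [he] with x hx; rw [hx])]) hf.measurable_mk
    refine h.congr fun s => ?_
    congr 1
    refine measure_congr ?_
    filter_upwards [he] with x hx
    exact propext (by change s < hf.mk f x ↔ s < f x; rw [hx])
  have hset : ∀ s : ℝ, MeasurableSet {x | s < f x} := fun s =>
    measurableSet_lt measurable_const hm
  have h1 : ∀ s : ℝ, ENNReal.ofReal (s ^ p) * μ {x | s < f x} =
      ∫⁻ x, indicator {x | s < f x} (fun _ => ENNReal.ofReal (s ^ p)) x ∂μ := fun s => by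
    rw [lintegral_indicator_const (hset s)]
  simp only [h1]
  rw [← lintegral_zero (μ := μ)]
  have hpow : Tendsto (fun s : ℝ => ENNReal.ofReal (s ^ p)) (𝓝[>] 0) (𝓝 0) := by
    have := (Real.continuousAt_rpow_const 0 p (Or.inr hp.le)).tendsto
    rw [Real.zero_rpow hp.ne'] at this
    simpa using ENNReal.tendsto_ofReal (this.mono_left nhdsWithin_le_nhds)
  refine tendsto_lintegral_filter_of_dominated_convergence _ ?_ ?_ hfin ?_
  · exact Eventually.of_forall fun s => measurable_const.indicator (hset s)
  · filter_upwards [self_mem_nhdsWithin] with s hs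
    refine Eventually.of_forall fun x => indicator_apply_le' (fun hx => ?_) fun _ => zero_le
    have hx' : s < f x := hx
    have hs' : (0 : ℝ) < s := hs
    exact ENNReal.ofReal_le_ofReal (Real.rpow_le_rpow hs'.le hx'.le hp.le)
  · refine Eventually.of_forall fun x => ?_
    exact tendsto_of_tendsto_of_tendsto_of_le_of_le tendsto_const_nhds hpow (fun _ => zero_le)
      fun s => indicator_le_self _ _ x

end Tail

/-! ### Hardy weights and the spectral estimates -/

namespace RegularTree

variable {Γ : RegularTree} {ψ : ℝ → ℝ}

/-- The infimum in the Hardy constant is attained: let `C` decrease to 1, using that the energy is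
finite. -/
theorem lintegral_hardy_le {Ψ : Γ.Point → ℝ} (hH : hardyConstant Ψ = 1)
    {u u' : Γ.Point → ℂ} (hu : MemH10 u u') :
    ∫⁻ x, ENNReal.ofReal (Ψ x) * ‖u x‖ₑ ^ 2 ≤ ∫⁻ x, ‖u' x‖ₑ ^ 2 := by
  have hD := (lintegral_sq_lt_top hu.memLp_deriv).ne
  have h : ∀ C : ℝ≥0∞, 1 < C → ∫⁻ x, ENNReal.ofReal (Ψ x) * ‖u x‖ₑ ^ 2 ≤
      C * ∫⁻ x, ‖u' x‖ₑ ^ 2 := by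
    intro C hC
    rw [← hH] at hC
    obtain ⟨C', hC', hlt⟩ := sInf_lt_iff.1 hC
    exact (hC' u u' hu).trans (by gcongr)
  have hlim : Tendsto (fun C : ℝ≥0∞ => C * ∫⁻ x, ‖u' x‖ₑ ^ 2) (𝓝[>] 1)
      (𝓝 (1 * ∫⁻ x, ‖u' x‖ₑ ^ 2)) :=
    ((ENNReal.continuous_mul_const hD).tendsto 1).mono_left nhdsWithin_le_nhds
  rw [one_mul] at hlim
  have : (𝓝[>] (1 : ℝ≥0∞)).NeBot := nhdsGT_neBot_of_exists_gt ⟨2, by norm_num⟩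
  refine ge_of_tendsto hlim ?_
  filter_upwards [self_mem_nhdsWithin] with C hC using h C hC

theorem aemeasurable_radial (hψ : AEMeasurable ψ (volume.restrict (Ioi 0))) :
    AEMeasurable (radial ψ : Γ.Point → ℝ) volume :=
  hψ.comp_quasiMeasurePreserving quasiMeasurePreserving_height

theorem ae_radial_pos (hpos : ∀ s, 0 < s → 0 < ψ s) :
    ∀ᵐ x : Γ.Point, 0 < radial ψ x := by
  filter_upwards [ae_height_pos] with x hx using hpos _ hx

theorem aemeasurable_weight (hψ : AEMeasurable ψ (volume.restrict (Ioi 0))) :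
    AEMeasurable (fun x : Γ.Point => ENNReal.ofReal (x.height * radial ψ x)) volume :=
  (measurable_height.aemeasurable.mul (aemeasurable_radial hψ)).ennreal_ofReal

theorem aemeasurable_ratio (hψ : AEMeasurable ψ (volume.restrict (Ioi 0))) {V : Γ.Point → ℝ}
    (hV : AEMeasurable V volume) :
    AEMeasurable (fun x => V x / radial ψ x) (weightedMeasure (radial ψ)) :=
  (hV.div (aemeasurable_radial hψ)).mono_ac (withDensity_absolutelyContinuous _ _)

/-- Dividing by the weight is legitimate off a null set: `ψ` is positive only away from the root. -/
theorem distribution_eq (hψ : AEMeasurable ψ (volume.restrict (Ioi 0)))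
    (hpos : ∀ s, 0 < s → 0 < ψ s) {V : Γ.Point → ℝ} (hV : AEMeasurable V volume) (t : ℝ) :
    distribution (radial ψ) V t = weightedMeasure (radial ψ) {x | t < V x / radial ψ x} := by
  have hm : NullMeasurableSet {x : Γ.Point | t < V x / radial ψ x} volume :=
    nullMeasurableSet_lt aemeasurable_const (hV.div (aemeasurable_radial hψ))
  unfold weightedMeasure distribution
  rw [withDensity_apply₀ _ hm]
  refine setLIntegral_congr ?_
  filter_upwards [ae_radial_pos hpos] with x hx
  exact propext (lt_div_iff₀ hx).symm

theorem lintegral_weightedMeasure (hψ : AEMeasurable ψ (volume.restrict (Ioi 0)))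
    {g : Γ.Point → ℝ≥0∞} (hg : AEMeasurable g volume) :
    ∫⁻ x, g x ∂(weightedMeasure (radial ψ)) =
      ∫⁻ x, ENNReal.ofReal (x.height * radial ψ x) * g x :=
  lintegral_withDensity_eq_lintegral_mul₀ (aemeasurable_weight hψ) hg

/-- The splitting at `Ψ/2`: Hardy handles the part below, and `|x|` times the part above is `αΦ (V/Ψ
- 1/(2α))₊`, whose integral is the tail integral by layer cake. -/
theorem spectral_bounds_of_tail (hψ : AEMeasurable ψ (volume.restrict (Ioi 0)))
    (hpos : ∀ s, 0 < s → 0 < ψ s) (hH : hardyConstant (radial ψ : Γ.Point → ℝ) = 1)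
    {V : Γ.Point → ℝ} (hV : AEMeasurable V volume) (hV0 : ∀ x, 0 ≤ V x) {α : ℝ} (hα : 0 < α)
    (hfin : ∫⁻ s in Ioi (2 * α)⁻¹, distribution (radial ψ) V s ≠ ∞) :
    (HasFiniteNegativeSpectrum fun x => α * V x) ∧ countNeg V α ≤
      2 * (ENNReal.ofReal α * ∫⁻ s in Ioi (2 * α)⁻¹, distribution (radial ψ) V s) := by
  have hΨ := aemeasurable_radial (Γ := Γ) hψ
  -- The sign of `ψ` at 0 is not prescribed, so the maximum with 0 keeps `W₁` nonnegative at the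
  -- root as well.
  let W₁ : Γ.Point → ℝ := fun x => min (α * V x) (max (radial ψ x) 0 / 2)
  have hW₁ : AEMeasurable W₁ volume :=
    (hV.const_mul α).min ((hΨ.max aemeasurable_const).div_const 2)
  have hI : ∫⁻ x, ENNReal.ofReal (x.height * (α * V x - W₁ x)) =
      ENNReal.ofReal α * ∫⁻ s in Ioi (2 * α)⁻¹, distribution (radial ψ) V s := by
    simp only [distribution_eq hψ hpos hV]
    rw [← lintegral_sub_pos_eq (aemeasurable_ratio hψ hV), lintegral_weightedMeasure hψ
      (g := fun x => ENNReal.ofReal (V x / radial ψ x - (2 * α)⁻¹))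
      ((hV.div hΨ).sub_const _).ennreal_ofReal, ← lintegral_const_mul''
      (f := fun x => ENNReal.ofReal (x.height * radial ψ x) *
        ENNReal.ofReal (V x / radial ψ x - (2 * α)⁻¹)) _
      ((aemeasurable_weight hψ).mul ((hV.div hΨ).sub_const _).ennreal_ofReal)]
    refine lintegral_congr_ae ?_
    filter_upwards [ae_height_pos, ae_radial_pos hpos] with x hx hr
    rw [← ENNReal.ofReal_mul (by positivity), ← ENNReal.ofReal_mul hα.le]
    have e : α * (x.height * radial ψ x * (V x / radial ψ x - (2 * α)⁻¹)) =
        x.height * (α * V x - radial ψ x / 2) := by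
      field_simp
    rw [e]
    simp only [W₁, max_eq_left hr.le]
    rcases le_total (α * V x) (radial ψ x / 2) with h | h
    · rw [min_eq_left h, sub_self, mul_zero, ENNReal.ofReal_zero, ENNReal.ofReal_of_nonpos]
      exact mul_nonpos_of_nonneg_of_nonpos hx.le (by linarith)
    · rw [min_eq_right h]
  have hS : IsSplitting (fun x => α * V x) W₁ fun x => α * V x - W₁ x := by
    refine ⟨fun x => by ring, fun x => ?_, fun x => ?_, hW₁, (hV.const_mul α).sub hW₁,
      fun u u' hu => ?_, ?_⟩
    · exact le_min (mul_nonneg hα.le (hV0 x)) (by positivity)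
    · exact sub_nonneg.2 (min_le_left _ _)
    · calc ∫⁻ x, ENNReal.ofReal (W₁ x) * ‖u x‖ₑ ^ 2
          ≤ ∫⁻ x, 2⁻¹ * (ENNReal.ofReal (radial ψ x) * ‖u x‖ₑ ^ 2) := by
            refine lintegral_mono fun x => ?_
            rw [← mul_assoc]
            gcongr
            refine (ENNReal.ofReal_le_ofReal (min_le_right _ _)).trans (le_of_eq ?_)
            rw [ENNReal.ofReal_div_of_pos two_pos, ENNReal.ofReal_max]
            simp [ENNReal.div_eq_inv_mul]
        _ = 2⁻¹ * ∫⁻ x, ENNReal.ofReal (radial ψ x) * ‖u x‖ₑ ^ 2 :=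
            lintegral_const_mul' _ _ (by simp)
        _ ≤ _ := mul_le_mul_right (lintegral_hardy_le hH hu) _
    · rw [hI]
      exact ENNReal.mul_ne_top ENNReal.ofReal_ne_top hfin
  have h := hS.spectral_bounds
  rw [hI] at h
  exact h

theorem spectral_bounds_of_weak_bound {p : ℝ} (hp : 1 < p) (hψ : AEMeasurable ψ (volume.restrict (Ioi 0)))
    (hpos : ∀ s, 0 < s → 0 < ψ s) (hH : hardyConstant (radial ψ : Γ.Point → ℝ) = 1)
    {V : Γ.Point → ℝ} (hV : AEMeasurable V volume) (hV0 : ∀ x, 0 ≤ V x) {M : ℝ≥0∞} (hM : M ≠ ∞)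
    (hbound : ∀ s, 0 < s → ENNReal.ofReal (s ^ p) * distribution (radial ψ) V s ≤ M) :
    (∀ α : ℝ, 0 < α → HasFiniteNegativeSpectrum fun x => α * V x) ∧
    (∀ α : ℝ, 0 < α → countNeg V α ≤ tailConst p * ENNReal.ofReal (α ^ p) * M) ∧
    limsup (fun α : ℝ => countNeg V α / ENNReal.ofReal (α ^ p)) atTop ≤
      tailConst p * limsup (fun t : ℝ => ENNReal.ofReal (t ^ p) * distribution (radial ψ) V t)
        (𝓝[>] 0) := by
  have h : ∀ α : ℝ, 0 < α → _ := fun α hα => spectral_bounds_of_tail hψ hpos hH hV hV0 hα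
    (ne_top_of_le_ne_top (ENNReal.mul_ne_top hM ENNReal.ofReal_ne_top)
      (lintegral_tail_le hp (by positivity) hbound))
  exact ⟨fun α hα => (h α hα).1, fun α hα => le_of_tail hp hbound (fun α hα => (h α hα).2) hα,
    limsup_le_of_tail hp hM hbound fun α hα => (h α hα).2⟩

theorem tendsto_zero_of_limsup_le {f : ℝ → ℝ≥0∞} {F : Filter ℝ} (h : limsup f F ≤ 0) :
    Tendsto f F (𝓝 0) :=
  tendsto_of_le_liminf_of_limsup_le zero_le h

/-- The supremum is bounded by the `p`-th power of the weak quasi-norm. -/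
theorem distribution_bound_of_memWeakLp {p : ℝ} (hp : 1 < p)
    (hψ : AEMeasurable ψ (volume.restrict (Ioi 0))) (hpos : ∀ s, 0 < s → 0 < ψ s)
    {V : Γ.Point → ℝ} (hV : AEMeasurable V volume)
    (hw : MemWeakLp (fun x => V x / radial ψ x) p (weightedMeasure (radial ψ))) :
    ⨆ (t : ℝ) (_ : 0 < t), ENNReal.ofReal (t ^ p) * distribution (radial ψ) V t ≠ ∞ := by
  have hp0 : 0 < p := by linarith
  refine ne_top_of_le_ne_top (ENNReal.rpow_ne_top_of_nonneg hp0.le hw.2.ne) ?_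
  refine iSup₂_le fun t ht => ?_
  have h1 : ENNReal.ofReal t * weightedMeasure (radial ψ)
      {x | t < |V x / radial ψ x|} ^ (1 / p) ≤
      weakLpQuasinorm (fun x => V x / radial ψ x) p (weightedMeasure (radial ψ)) :=
    le_iSup₂_of_le t ht le_rfl
  have h2 := ENNReal.rpow_le_rpow h1 hp0.le
  rw [ENNReal.mul_rpow_of_nonneg _ _ hp0.le, ← ENNReal.rpow_mul, one_div_mul_cancel hp0.ne',
    ENNReal.rpow_one, ENNReal.ofReal_rpow_of_pos ht] at h2
  refine le_trans ?_ h2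
  rw [distribution_eq hψ hpos hV]
  gcongr
  exact le_abs_self _

end RegularTree
end

/-! ### The main theorem -/

open RegularTree

theorem mainTheorem2 (p : ℝ) (hp : 1 < p) :
    ∃ C : ℝ≥0, ∀ (Γ : RegularTree) (ψ : ℝ → ℝ),
      AEMeasurable ψ (volume.restrict (Ioi 0)) →
      (∀ s : ℝ, 0 < s → 0 < ψ s) →
      hardyConstant (radial ψ : Γ.Point → ℝ) = 1 →
      ∀ V : Γ.Point → ℝ, AEMeasurable V volume → (∀ x, 0 ≤ V x) →
        (MemWeakLp (fun x => V x / radial ψ x) p (weightedMeasure (radial ψ)) →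
          (∀ α : ℝ, 0 < α → HasFiniteNegativeSpectrum fun x => α * V x) ∧
          (∀ α : ℝ, 0 < α → countNeg V α ≤ C * ENNReal.ofReal (α ^ p) *
            ⨆ (t : ℝ) (_ : 0 < t), ENNReal.ofReal (t ^ p) * distribution (radial ψ) V t) ∧
          limsup (fun α : ℝ => countNeg V α / ENNReal.ofReal (α ^ p)) atTop ≤
            C * limsup (fun t : ℝ => ENNReal.ofReal (t ^ p) * distribution (radial ψ) V t)
              (𝓝[>] 0 ⊔ atTop) ∧
          (Tendsto (fun t : ℝ => ENNReal.ofReal (t ^ p) * distribution (radial ψ) V t)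
              (𝓝[>] 0 ⊔ atTop) (𝓝 0) →
            Tendsto (fun α : ℝ => countNeg V α / ENNReal.ofReal (α ^ p)) atTop (𝓝 0))) ∧
        (MemLp (fun x => V x / radial ψ x) (ENNReal.ofReal p) (weightedMeasure (radial ψ)) →
          (∀ α : ℝ, 0 < α → HasFiniteNegativeSpectrum fun x => α * V x) ∧
          (∀ α : ℝ, 0 < α → countNeg V α ≤ C * ENNReal.ofReal (α ^ p) *
            ∫⁻ x, ENNReal.ofReal (x.height * V x ^ p * radial ψ x ^ (1 - p))) ∧
          Tendsto (fun α : ℝ => countNeg V α / ENNReal.ofReal (α ^ p)) atTop (𝓝 0)) := by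
  have hp0 : 0 < p := by linarith
  refine ⟨tailConst p, fun Γ ψ hψ hpos hH V hV hV0 => ⟨fun hw => ?_, fun hL => ?_⟩⟩
  · obtain ⟨h1, h2, h3⟩ := spectral_bounds_of_weak_bound hp hψ hpos hH hV hV0
      (distribution_bound_of_memWeakLp hp hψ hpos hV hw)
      fun s hs => le_iSup₂_of_le (f := fun (t : ℝ) (_ : 0 < t) =>
        ENNReal.ofReal (t ^ p) * distribution (radial ψ) V t) s hs le_rfl
    -- The limsup at zero alone is no larger than the one over both ends, so the bound proved is
    -- stronger than needed.
    have h4 : limsup (fun α : ℝ => countNeg V α / ENNReal.ofReal (α ^ p)) atTop ≤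
        tailConst p * limsup (fun t : ℝ => ENNReal.ofReal (t ^ p) * distribution (radial ψ) V t)
          (𝓝[>] 0 ⊔ atTop) :=
      h3.trans (by gcongr; exact limsup_le_limsup_of_le le_sup_left)
    refine ⟨h1, h2, h4, fun ht => tendsto_zero_of_limsup_le (h4.trans ?_)⟩
    rw [ht.limsup_eq, mul_zero]
  · have hf := aemeasurable_ratio hψ hV
    have hI : ∫⁻ x, ENNReal.ofReal ((V x / radial ψ x) ^ p) ∂(weightedMeasure (radial ψ)) =
        ∫⁻ x, ENNReal.ofReal (x.height * V x ^ p * radial ψ x ^ (1 - p)) := by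
      rw [lintegral_weightedMeasure hψ (g := fun x => ENNReal.ofReal ((V x / radial ψ x) ^ p))
        ((hV.div (aemeasurable_radial hψ)).pow_const p).ennreal_ofReal]
      refine lintegral_congr_ae ?_
      filter_upwards [ae_height_pos, ae_radial_pos hpos] with x hx hr
      rw [← ENNReal.ofReal_mul (by positivity)]
      congr 1
      rw [Real.div_rpow (hV0 x) hr.le, Real.rpow_sub hr, Real.rpow_one]
      field_simp
    have hfin : ∫⁻ x, ENNReal.ofReal ((V x / radial ψ x) ^ p) ∂(weightedMeasure (radial ψ)) ≠
        ∞ := by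
      have h1 := lintegral_rpow_enorm_lt_top_of_eLpNorm_lt_top
        (by simpa using hp0) ENNReal.ofReal_ne_top hL.2
      rw [ENNReal.toReal_ofReal hp0.le] at h1
      refine ne_top_of_le_ne_top h1.ne (lintegral_mono fun x => ?_)
      rw [← ofReal_norm, ENNReal.ofReal_rpow_of_nonneg (norm_nonneg _) hp0.le, Real.norm_eq_abs]
      exact ENNReal.ofReal_le_ofReal ((le_abs_self _).trans (Real.abs_rpow_le_abs_rpow _ _))
    -- By Chebyshev the `L_p` integral serves as the weak bound `M`, so the same constant works in
    -- both parts.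
    have hb : ∀ s, 0 < s → ENNReal.ofReal (s ^ p) * distribution (radial ψ) V s ≤
        ∫⁻ x, ENNReal.ofReal ((V x / radial ψ x) ^ p) ∂(weightedMeasure (radial ψ)) := by
      intro s hs
      rw [distribution_eq hψ hpos hV]
      exact rpow_mul_meas_le hf hp0 hs
    obtain ⟨h1, h2, h3⟩ := spectral_bounds_of_weak_bound hp hψ hpos hH hV hV0 hfin hb
    refine ⟨h1, fun α hα => hI ▸ h2 α hα, tendsto_zero_of_limsup_le (h3.trans ?_)⟩
    -- For `V/Ψ` in `L_p` the limsup at zero vanishes, which is all that the asymptotic bound needs.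
    have h4 := tendsto_rpow_mul_meas hf hp0 hfin
    simp only [← distribution_eq hψ hpos hV] at h4
    rw [h4.limsup_eq, mul_zero]
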